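/- Proposition 4.1 (lower bound). Let $\mathbb S^n$ be the unit round sphere with metric $g$ and Levi-Civita connection $\nabla$, let $1\le k\le n-1$ be an integer and $0<p_0<k$ a real number, and let $a>0$ and $L$ be real numbers. There is a constant $C>0$, depending only on $n,k,p_0,a$ and $L$, with the following property. Let $f\in C^1(\mathbb S^n)$ satisfy $\min f\ge a$ and $\|f\|_{C^1}:=\max\{\sup|f|,\ \sup|\nabla f|\}\le L$, and let $u\in C^2(\mathbb S^n)$ be a positive, even ($u(-x)=u(x)$), spherically convex ($W_u:=\nabla^2u+u\,g\ge 0$ on $\mathbb S^n$) solution of $$\sigma_k(\nabla^2 u+u\,g)=u^{p_0}f\quad\text{on }\mathbb S^n,\qquad (\mathrm{CMpk})$$ where $\sigma_k$ is the $k$-th elementary symmetric function of the eigenvalues (with respect to $g$). Then $$u\ge C>0\quad\text{on }\mathbb S^n .$$ -/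

import Mathlib

open scoped Manifold ContDiff RealInnerProductSpace

noncomputable section

namespace LpCM

/-- The ambient Euclidean space `ℝ^{n+1}`. -/
abbrev E (n : ℕ) : Type := EuclideanSpace ℝ (Fin (n + 1))

/-- The unit sphere `S^n` in `ℝ^{n+1}`, with Mathlib's smooth structure. -/
abbrev Sph (n : ℕ) : Type := Metric.sphere (0 : E n) 1

/-- The tangent space `T_x S^n = x^⊥`, with the inner product of `ℝ^{n+1}`
(that is, with the round metric at `x`). -/
abbrev Tan {n : ℕ} (x : Sph n) : Submodule ℝ (E n) := (ℝ ∙ (x : E n))ᗮ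

/-- The extension of `u : S^n → ℝ` to `ℝ^{n+1}`, positively homogeneous of degree `0`:
`X ↦ u (X / |X|)` for `X ≠ 0` (and the value `0` at the origin, which plays no role). -/
def radExt {n : ℕ} (u : Sph n → ℝ) (X : E n) : ℝ :=
  if h : X ≠ 0 then u ⟨‖X‖⁻¹ • X, by simp [norm_smul, h]⟩ else 0

/-- The gradient `∇u(x)` on the round sphere. The radial derivative of `radExt u` vanishes, so
its Euclidean gradient at a point of the sphere is tangential and is the Riemannian gradient. -/
def sphGrad {n : ℕ} (u : Sph n → ℝ) (x : Sph n) : E n := gradient (radExt u) x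

/-- The covariant Hessian `∇²u(x)(v, w)` on the round sphere, for tangent vectors `v`, `w`.
The Levi-Civita derivative on the sphere is the tangential part of the Euclidean one, so
`∇²u(v, w) = ⟨D_v (∇u), w⟩`, and with the extension of `∇u` by the Euclidean gradient of
`radExt u` this is the Euclidean second derivative of `radExt u`. The lemma
`sphHess_eq_deriv2_greatCircle` below identifies it with the second derivative of `u`
along geodesics. -/
def sphHess {n : ℕ} (u : Sph n → ℝ) (x : Sph n) (v w : E n) : ℝ :=
  fderiv ℝ (fderiv ℝ (radExt u)) (x : E n) v w

/-- `W_u = ∇²u + u g`, as a bilinear form on tangent vectors at `x`. -/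
def W {n : ℕ} (u : Sph n → ℝ) (x : Sph n) (v w : E n) : ℝ :=
  sphHess u x v w + u x * ⟪v, w⟫

/-- The `k`-th elementary symmetric function of a square matrix: the sum of its principal
`k × k` minors (for a symmetric matrix: the `k`-th elementary symmetric function of the
eigenvalues). -/
def sigma {ι : Type} [Fintype ι] [DecidableEq ι] (k : ℕ) (A : Matrix ι ι ℝ) : ℝ :=
  ∑ s ∈ Finset.univ.powersetCard k,
    (A.submatrix (Subtype.val : s → ι) (Subtype.val : s → ι)).det

/-- The matrix of `W_u` at `x` in an orthonormal frame of the tangent space. -/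
def Wmat {n : ℕ} (u : Sph n → ℝ) (x : Sph n) (b : OrthonormalBasis (Fin n) ℝ (Tan x)) :
    Matrix (Fin n) (Fin n) ℝ :=
  Matrix.of fun i j => W u x (b i : E n) (b j : E n)

/-- Some orthonormal basis of the tangent space. -/
def frame {n : ℕ} (x : Sph n) : OrthonormalBasis (Fin n) ℝ (Tan x) :=
  haveI : Fact (Module.finrank ℝ (E n) = n + 1) := ⟨finrank_euclideanSpace_fin⟩
  OrthonormalBasis.fromOrthogonalSpanSingleton n (ne_zero_of_mem_unit_sphere x)

/-- `σ_k(W_u)` at `x`. It does not depend on the orthonormal frame, see `sigmaW_eq`. -/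
def sigmaW {n : ℕ} (k : ℕ) (u : Sph n → ℝ) (x : Sph n) : ℝ := sigma k (Wmat u x (frame x))

/-- `u` is spherically convex: `W_u = ∇²u + u g ≥ 0` on all tangent spaces. -/
def SphericallyConvex {n : ℕ} (u : Sph n → ℝ) : Prop :=
  ∀ x : Sph n, ∀ v ∈ Tan x, 0 ≤ W u x v v

/-- `u` is a solution of `σ_k(∇²u + u g) = u^{p₀} f` on `S^n`, in the classical sense:
`u` is of class `C²` and the equation holds pointwise. -/
def IsSolution {n : ℕ} (k : ℕ) (p₀ : ℝ) (f u : Sph n → ℝ) : Prop :=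
  ContMDiff (𝓡 n) 𝓘(ℝ, ℝ) 2 u ∧ ∀ x : Sph n, sigmaW k u x = u x ^ p₀ * f x

theorem W_bilin {n : ℕ} (u : Sph n → ℝ) (x : Sph n) {ι : Type} [Fintype ι] (c d : ι → ℝ)
    (e e' : ι → E n) :
    W u x (∑ i, c i • e i) (∑ j, d j • e' j) = ∑ i, ∑ j, c i * W u x (e i) (e' j) * d j := by
  have h1 : ∀ z, W u x (∑ i, c i • e i) z = ∑ i, c i * W u x (e i) z := by
    intro z
    simp only [W, sphHess, map_sum, map_smul, sum_apply, smul_apply, sum_inner,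
      real_inner_smul_left, Finset.mul_sum, smul_eq_mul, mul_add, Finset.sum_add_distrib]
    congr 1
    exact Finset.sum_congr rfl fun i _ => by ring
  have h2 : ∀ z, W u x z (∑ j, d j • e' j) = ∑ j, W u x z (e' j) * d j := by
    intro z
    simp only [W, sphHess, map_sum, map_smul, inner_sum,
      real_inner_smul_right, Finset.mul_sum, smul_eq_mul, add_mul, Finset.sum_add_distrib]
    congr 1 <;> exact Finset.sum_congr rfl fun i _ => by ring
  rw [h1]
  simp only [h2, Finset.mul_sum, mul_assoc]

theorem sigmaW_eq {n : ℕ} (k : ℕ) (hk : k ≤ n) (u : Sph n → ℝ) (x : Sph n)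
    (b : OrthonormalBasis (Fin n) ℝ (Tan x)) :
    sigmaW k u x = sigma k (Wmat u x b) := by
  have key : ∀ A : Matrix (Fin n) (Fin n) ℝ,
      sigma k A = (-1) ^ k * A.charpoly.coeff (n - k) := by
    intro A
    have h := Matrix.charpoly_coeff_eq_sum_minors A k (by simpa using hk)
    rw [Fintype.card_fin] at h
    rw [h, ← mul_assoc, ← mul_pow]
    simp [sigma]
  set c := frame x
  set P : Matrix (Fin n) (Fin n) ℝ := c.toBasis.toMatrix b with hP
  have hO : P ∈ Matrix.orthogonalGroup (Fin n) ℝ := c.toMatrix_orthonormalBasis_mem_orthogonal b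
  have hW : Wmat u x b = P.transpose * Wmat u x c * P := by
    ext i j
    have hb : ∀ i, (b i : E n) = ∑ l, P l i • (c l : E n) := by
      intro i
      have := congrArg (Subtype.val) (c.toBasis.sum_toMatrix_smul_self b i)
      rw [← this]
      simp [hP]
    simp only [Wmat, Matrix.of_apply, Matrix.mul_apply, Matrix.transpose_apply, hb, W_bilin,
      Finset.sum_mul]
    rw [Finset.sum_comm]
  have h1 : P.transpose * P = 1 := by
    simpa [Matrix.star_eq_conjTranspose] using (Matrix.mem_orthogonalGroup_iff' _ _).1 hO
  rw [sigmaW, key, key, hW, Matrix.mul_assoc, Matrix.charpoly_mul_comm, Matrix.mul_assoc,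
    mul_eq_one_comm.1 h1, mul_one]

theorem contDiffAt_radExt {n : ℕ} {m : ℕ∞ω} {u : Sph n → ℝ} (hu : ContMDiff (𝓡 n) 𝓘(ℝ, ℝ) m u)
    {X : E n} (hX : X ≠ 0) : ContDiffAt ℝ m (radExt u) X := by
  let U : TopologicalSpace.Opens (E n) := ⟨{0}ᶜ, isOpen_compl_singleton⟩
  have hne : ∀ Y : U, (Y : E n) ≠ 0 := fun Y => Y.2
  have : Fact (Module.finrank ℝ (E n) = n + 1) := ⟨finrank_euclideanSpace_fin⟩
  have h1 : ContMDiff 𝓘(ℝ, E n) 𝓘(ℝ, E n) m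
      (fun Y : U => ‖(Y : E n)‖⁻¹ • (Y : E n)) := by
    intro Y
    refine (contMDiffAt_subtype_iff (U := U) (f := fun Z : E n => ‖Z‖⁻¹ • Z)).2 ?_
    rw [contMDiffAt_iff_contDiffAt]
    exact ((contDiffAt_norm ℝ (hne Y)).inv (norm_ne_zero_iff.2 (hne Y))).smul contDiffAt_id
  have h2 := ContMDiff.codRestrict_sphere (n := n) h1
    (fun Y => by simp [norm_smul, hne Y])
  have h3 : ContMDiff 𝓘(ℝ, E n) 𝓘(ℝ, ℝ) m (fun Y : U => radExt u Y) := by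
    refine (hu.comp h2).congr fun Y => ?_
    simp only [radExt, dif_pos (hne Y), Function.comp]
    rfl
  have h4 := (contMDiffAt_subtype_iff (U := U) (f := radExt u) (x := ⟨X, hX⟩)).1 (h3 ⟨X, hX⟩)
  exact contMDiffAt_iff_contDiffAt.1 h4

/-- The Hessian is the second derivative along unit-speed geodesics (great circles). -/
theorem sphHess_eq_deriv2_greatCircle {n : ℕ} {u : Sph n → ℝ}
    (hu : ContMDiff (𝓡 n) 𝓘(ℝ, ℝ) 2 u) (x : Sph n) (v : E n) (hv : v ∈ Tan x) (hv1 : ‖v‖ = 1) :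
    sphHess u x v v =
      deriv (deriv fun t : ℝ => radExt u (Real.cos t • (x : E n) + Real.sin t • v)) 0 := by
  have hx1 : ‖(x : E n)‖ = 1 := norm_eq_of_mem_sphere x
  have hxv : ⟪(x : E n), v⟫ = 0 := Submodule.mem_orthogonal_singleton_iff_inner_right.1 hv
  set c : ℝ → E n := fun t => Real.cos t • (x : E n) + Real.sin t • v with hc
  set c' : ℝ → E n := fun t => -Real.sin t • (x : E n) + Real.cos t • v with hc'
  have hcd : ∀ t, HasDerivAt c (c' t) t := fun t =>
    ((Real.hasDerivAt_cos t).smul_const _).add ((Real.hasDerivAt_sin t).smul_const _)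
  have hcd' : ∀ t, HasDerivAt c' (-c t) t := by
    intro t
    have := ((Real.hasDerivAt_sin t).neg.smul_const (x : E n)).add
      ((Real.hasDerivAt_cos t).smul_const v)
    have e : -c t = -Real.cos t • (x : E n) + -Real.sin t • v := by
      simp only [hc, neg_add, neg_smul]
    rw [e]
    exact this
  have hc0 : ∀ t, c t ≠ 0 := by
    intro t h
    have h1 : ⟪c t, c t⟫ = 1 := by
      simp only [hc, inner_add_left, inner_add_right, real_inner_smul_left,
        real_inner_smul_right, hxv, real_inner_comm (x : E n) v]
      rw [real_inner_self_eq_norm_sq, real_inner_self_eq_norm_sq, hx1, hv1]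
      nlinarith [Real.sin_sq_add_cos_sq t]
    simp [h] at h1
  have hd1 : deriv (fun t => radExt u (c t)) = fun t => fderiv ℝ (radExt u) (c t) (c' t) := by
    funext t
    exact (((contDiffAt_radExt hu (hc0 t)).differentiableAt
      two_ne_zero).hasFDerivAt.comp_hasDerivAt t (hcd t)).deriv
  have hc00 : c 0 = x := by simp [hc]
  have hc'0 : c' 0 = v := by simp [hc']
  have hx0 : (x : E n) ≠ 0 := hc00 ▸ hc0 0
  have hrad : fderiv ℝ (radExt u) (x : E n) (x : E n) = 0 := by
    have hl : HasDerivAt (fun s : ℝ => s • (x : E n)) ((1 : ℝ) • (x : E n)) 1 :=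
      (hasDerivAt_id (1 : ℝ)).smul_const _
    have hF : HasFDerivAt (radExt u) (fderiv ℝ (radExt u) x) ((1 : ℝ) • (x : E n)) := by
      rw [one_smul]
      exact ((contDiffAt_radExt hu hx0).differentiableAt two_ne_zero).hasFDerivAt
    have h1 := hF.comp_hasDerivAt (1 : ℝ) hl
    rw [one_smul] at h1
    have h2 : HasDerivAt (radExt u ∘ fun s : ℝ => s • (x : E n)) 0 1 := by
      refine (hasDerivAt_const (1 : ℝ) (radExt u x)).congr_of_eventuallyEq ?_
      filter_upwards [lt_mem_nhds (zero_lt_one' ℝ)] with s hs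
      have : s • (x : E n) ≠ 0 := smul_ne_zero hs.ne' hx0
      simp [radExt, this, hx0, norm_smul, hx1, abs_of_pos hs, smul_smul, hs.ne']
    exact h1.unique h2
  have hD : DifferentiableAt ℝ (fderiv ℝ (radExt u)) (c 0) :=
    ((contDiffAt_radExt hu (hc0 0)).fderiv_right (m := 1) (by norm_num)).differentiableAt
      one_ne_zero
  have h2 := (hD.hasFDerivAt.comp_hasDerivAt (0 : ℝ) (hcd 0)).clm_apply (hcd' 0)
  rw [hd1]
  have h3 := h2.deriv
  simp only [Function.comp, hc00, hc'0, map_neg, hrad] at h3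
  rw [sphHess]
  simpa using h3.symm

end LpCM

end

/-!
Let `N X = |X| u(X / |X|)` be the one-homogeneous extension of `u`. Since `u` is positive, even and
spherically convex, `N` is a norm, and its Euclidean Hessian at `x ∈ S^n` has the eigenvalues of
`∇²u + u g` together with a zero in the radial direction (`sigmaW_unitVec`). Hence `σ_k` can be
computed in any orthonormal basis of `ℝ^{n+1}`. Choose the basis adapted to `N`: minimizing `N`
greedily gives orthonormal `eᵢ`, with axes `bᵢ = N(eᵢ)`, such that
`N x ≥ 2^{-(n+1)} bᵢ |⟨eᵢ, x⟩|` (`exists_orthonormal_axes`). Let `m` be the smallest and `b` the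
largest axis, and `P` the largest product of `k` axes.

* Averaged over the cube `∑ yᵢ eᵢ`, `1 ≤ yᵢ ≤ 2`, the quantity `∑ ∂ᵢᵢN / bᵢ` is bounded, by the
  divergence theorem and `|∂ᵢN| ≤ bᵢ`. At some point of the cube all `∂ᵢᵢN` are thus `≲ bᵢ`, so
  `σ_k ≲ P` there, whereas `u ≳ b`; the equation yields `b^{p₀} ≲ P` (`rpow_axis_le`).
* Near the direction of the shortest axis, `N` is touched from below by a paraboloid with second
  derivatives `~ bⱼ² / m` in the `k` directions realizing `P`, at a point where `u ≲ m`. The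
  equation yields `P² / m^k ≲ m^{p₀}` (`sq_prod_axes_le`).

Since `P ≤ b^k` and `p₀ < k`, the first inequality bounds `b` from below, hence `P` from below, and
the second one then bounds `m` from below (`exists_lower_bound`). No derivatives beyond the second
are used.
-/

noncomputable section

namespace LpCM

/-! ### Elementary symmetric functions of matrices -/

/-- Nonnegativity of the `2 × 2` principal minors. -/
theorem sq_apply_le_of_posSemidef {ι : Type} {A : Matrix ι ι ℝ} (hA : A.PosSemidef) (i j : ι) :
    A i j ^ 2 ≤ A i i * A j j := by
  have h := (hA.submatrix ![i, j]).det_nonneg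
  have hs : A j i = A i j := by simpa using hA.1.apply i j
  rw [Matrix.det_fin_two] at h
  simp only [Matrix.submatrix_apply, Matrix.cons_val_zero, Matrix.cons_val_one, hs] at h
  linarith [sq (A i j)]

section Matrices

variable {ι : Type} [Fintype ι] [DecidableEq ι]

theorem sigma_eq_charpoly_coeff {k : ℕ} (hk : k ≤ Fintype.card ι) (A : Matrix ι ι ℝ) :
    sigma k A = (-1) ^ k * A.charpoly.coeff (Fintype.card ι - k) := by
  rw [Matrix.charpoly_coeff_eq_sum_minors A k hk, ← mul_assoc, ← mul_pow]
  simp [sigma]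

theorem sigma_orthogonal_conj {k : ℕ} (hk : k ≤ Fintype.card ι) (A : Matrix ι ι ℝ)
    {P : Matrix ι ι ℝ} (hP : P ∈ Matrix.orthogonalGroup ι ℝ) :
    sigma k (P.transpose * A * P) = sigma k A := by
  have h1 : P.transpose * P = 1 := by
    simpa [Matrix.star_eq_conjTranspose] using (Matrix.mem_orthogonalGroup_iff' _ _).1 hP
  rw [sigma_eq_charpoly_coeff hk, sigma_eq_charpoly_coeff hk, Matrix.mul_assoc,
    Matrix.charpoly_mul_comm, Matrix.mul_assoc, mul_eq_one_comm.1 h1, mul_one]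

theorem sigma_smul (k : ℕ) (c : ℝ) (A : Matrix ι ι ℝ) : sigma k (c • A) = c ^ k * sigma k A := by
  rw [sigma, sigma, Finset.mul_sum]
  refine Finset.sum_congr rfl fun s hs => ?_
  have : (c • A).submatrix (Subtype.val : s → ι) (Subtype.val : s → ι) =
      c • A.submatrix Subtype.val Subtype.val := rfl
  rw [this, Matrix.det_smul, Fintype.card_coe, (Finset.mem_powersetCard.1 hs).2]

/-- A vanishing first row only contributes a zero eigenvalue. -/
theorem sigma_submatrix_succ {n k : ℕ} (hk : k ≤ n) (A : Matrix (Fin (n + 1)) (Fin (n + 1)) ℝ)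
    (h0 : ∀ j, A 0 j = 0) : sigma k (A.submatrix Fin.succ Fin.succ) = sigma k A := by
  have hchar : A.charpoly = Polynomial.X * (A.submatrix Fin.succ Fin.succ).charpoly := by
    rw [Matrix.charpoly, Matrix.det_succ_row_zero, Fin.sum_univ_succ, Finset.sum_eq_zero, add_zero]
    · have : (A.charmatrix.submatrix Fin.succ (Fin.succAbove 0)) =
          (A.submatrix Fin.succ Fin.succ).charmatrix := by
        ext i j
        simp [Matrix.charmatrix, Matrix.scalar_apply, Matrix.diagonal_apply]
      rw [this]
      simp [h0, Matrix.charpoly]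
    · intro j _
      rw [Matrix.charmatrix_apply_ne _ _ _ (Fin.succ_ne_zero j).symm, h0]
      simp
  rw [sigma_eq_charpoly_coeff (by simpa using hk), sigma_eq_charpoly_coeff (by simp; omega),
    hchar, Fintype.card_fin, Fintype.card_fin, Nat.succ_sub hk, Polynomial.coeff_X_mul]

theorem det_submatrix_le_sigma {k : ℕ} {A : Matrix ι ι ℝ} (hA : A.PosSemidef) {s : Finset ι}
    (hs : s.card = k) :
    (A.submatrix (Subtype.val : s → ι) (Subtype.val : s → ι)).det ≤ sigma k A :=
  Finset.single_le_sum
    (f := fun s : Finset ι => (A.submatrix (Subtype.val : s → ι) (Subtype.val : s → ι)).det)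
    (fun _ _ => (hA.submatrix _).det_nonneg)
    (Finset.mem_powersetCard.2 ⟨Finset.subset_univ s, hs⟩)

/-- Monotonicity of the determinant, for a symmetric matrix above a positive diagonal one. -/
theorem prod_le_det {A : Matrix ι ι ℝ} (hA : A.IsHermitian) {q : ι → ℝ} (hq : ∀ i, 0 < q i)
    (h : ∀ v : ι → ℝ, ∑ i, q i * v i ^ 2 ≤ v ⬝ᵥ A.mulVec v) : ∏ i, q i ≤ A.det := by
  -- Rescaling by `q ^ (-1/2)` reduces to a matrix whose eigenvalues are at least `1`.
  set d : ι → ℝ := fun i => (Real.sqrt (q i))⁻¹ with hd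
  set B := Matrix.diagonal d * A * Matrix.diagonal d with hB
  have hBh : B.IsHermitian := by
    have := Matrix.isHermitian_conjTranspose_mul_mul (Matrix.diagonal d) hA
    simpa [hB, Matrix.diagonal_conjTranspose] using this
  have hquad : ∀ v : ι → ℝ, ∑ i, v i ^ 2 ≤ v ⬝ᵥ B.mulVec v := by
    intro v
    have e : v ⬝ᵥ B.mulVec v = (fun i => d i * v i) ⬝ᵥ A.mulVec (fun i => d i * v i) := by
      have e1 : (Matrix.diagonal d).mulVec v = fun i => d i * v i := by
        ext i; simp [Matrix.mulVec_diagonal]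
      have e2 : Matrix.vecMul v (Matrix.diagonal d) = fun i => d i * v i := by
        ext i; simp [Matrix.vecMul_diagonal, mul_comm]
      rw [hB, Matrix.mul_assoc, ← Matrix.mulVec_mulVec, ← Matrix.mulVec_mulVec, e1,
        Matrix.dotProduct_mulVec, e2]
    rw [e]
    refine le_trans (le_of_eq ?_) (h _)
    refine Finset.sum_congr rfl fun i _ => ?_
    rw [hd, mul_pow, inv_pow, Real.sq_sqrt (hq i).le, mul_inv_cancel_left₀ (hq i).ne']
  have heig : ∀ i, 1 ≤ hBh.eigenvalues i := by
    intro i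
    have h1 := hquad (hBh.eigenvectorBasis i)
    have h2 : ∑ j, (hBh.eigenvectorBasis i) j ^ 2 = 1 := by
      have := EuclideanSpace.real_norm_sq_eq (hBh.eigenvectorBasis i)
      rw [← this, hBh.eigenvectorBasis.orthonormal.1 i, one_pow]
    rw [hBh.mulVec_eigenvectorBasis i, dotProduct_smul, h2] at h1
    have h3 : (hBh.eigenvectorBasis i).ofLp ⬝ᵥ (hBh.eigenvectorBasis i).ofLp = 1 := by
      rw [← h2]; simp [dotProduct, sq]
    rwa [h3, smul_eq_mul, mul_one] at h1
  have hdet : 1 ≤ B.det := by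
    rw [hBh.det_eq_prod_eigenvalues]
    calc (1 : ℝ) = ∏ _i : ι, 1 := by simp
      _ ≤ _ := Finset.prod_le_prod (fun _ _ => zero_le_one) fun i _ => by simpa using heig i
  have hdd : (∏ i, d i) * (∏ i, d i) * ∏ i, q i = 1 := by
    rw [← Finset.prod_mul_distrib, ← Finset.prod_mul_distrib]
    refine Finset.prod_eq_one fun i _ => ?_
    rw [hd, ← mul_inv, Real.mul_self_sqrt (hq i).le, inv_mul_cancel₀ (hq i).ne']
  have hqp : 0 < ∏ i, q i := Finset.prod_pos fun i _ => hq i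
  rw [hB, Matrix.det_mul, Matrix.det_mul, Matrix.det_diagonal] at hdet
  calc ∏ i, q i ≤ (∏ i, q i) * ((∏ i, d i) * A.det * ∏ i, d i) := le_mul_of_one_le_right hqp.le hdet
    _ = A.det * ((∏ i, d i) * (∏ i, d i) * ∏ i, q i) := by ring
    _ = A.det := by rw [hdd, mul_one]

/-- A crude form of Hadamard's inequality for positive semidefinite matrices. -/
theorem det_le_of_diag_le {A : Matrix ι ι ℝ} (hA : A.PosSemidef) {c : ι → ℝ} (hc : ∀ i, 0 ≤ c i)
    (h : ∀ i, A i i ≤ c i) : A.det ≤ (Fintype.card ι).factorial * ∏ i, c i := by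
  have hent : ∀ i j, |A i j| ≤ Real.sqrt (c i) * Real.sqrt (c j) := by
    intro i j
    rw [← Real.sqrt_mul (hc i)]
    refine Real.abs_le_sqrt ((sq_apply_le_of_posSemidef hA i j).trans ?_)
    exact mul_le_mul (h i) (h j) hA.diag_nonneg (hc i)
  rw [Matrix.det_apply]
  calc ∑ σ : Equiv.Perm ι, Equiv.Perm.sign σ • ∏ i, A (σ i) i
      ≤ ∑ _σ : Equiv.Perm ι, ∏ i, c i := by
        refine Finset.sum_le_sum fun σ _ => (le_abs_self _).trans ?_
        have h1 : |Equiv.Perm.sign σ • ∏ i, A (σ i) i| = |∏ i, A (σ i) i| := by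
          rcases Int.units_eq_one_or (Equiv.Perm.sign σ) with h | h <;> simp [h]
        rw [h1, Finset.abs_prod]
        calc ∏ i, |A (σ i) i| ≤ ∏ i, (Real.sqrt (c (σ i)) * Real.sqrt (c i)) :=
              Finset.prod_le_prod (fun _ _ => abs_nonneg _) fun i _ => hent _ _
          _ = ∏ i, c i := by
              rw [Finset.prod_mul_distrib, Equiv.prod_comp σ fun i => Real.sqrt (c i),
                ← Finset.prod_mul_distrib]
              exact Finset.prod_congr rfl fun i _ => Real.mul_self_sqrt (hc i)
    _ = (Fintype.card ι).factorial * ∏ i, c i := by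
        rw [Finset.sum_const, Finset.card_univ, Fintype.card_perm, nsmul_eq_mul]

theorem sigma_le_of_diag_le {k : ℕ} {A : Matrix ι ι ℝ} (hA : A.PosSemidef) {b : ι → ℝ}
    (hb : ∀ i, 0 ≤ b i) {K P : ℝ} (hK : 0 ≤ K) (h : ∀ i, A i i ≤ K * b i)
    (hP : ∀ s : Finset ι, s.card = k → ∏ i ∈ s, b i ≤ P) :
    sigma k A ≤ (Fintype.card ι).choose k * (k.factorial * K ^ k * P) := by
  rw [sigma]
  refine (Finset.sum_le_card_nsmul _ _ (k.factorial * K ^ k * P) fun s hs => ?_).trans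
    (le_of_eq ?_)
  · have hs := (Finset.mem_powersetCard.1 hs).2
    refine (det_le_of_diag_le (hA.submatrix _) (c := fun i : s => K * b i)
      (fun i => mul_nonneg hK (hb i)) fun i => h i).trans ?_
    rw [Finset.prod_mul_distrib, Finset.prod_const, Finset.card_univ, Fintype.card_coe, hs,
      Finset.prod_coe_sort s b, ← mul_assoc]
    exact mul_le_mul_of_nonneg_left (hP s hs) (by positivity)
  · rw [Finset.card_powersetCard, Finset.card_univ, nsmul_eq_mul]

end Matrices

/-- Among the `k`-subsets, one with the largest product of weights can be chosen to avoid an index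
of smallest weight. -/
theorem exists_max_prod {ι : Type} [Fintype ι] [DecidableEq ι] {k : ℕ} (hk : k < Fintype.card ι)
    {b : ι → ℝ} (hb : ∀ i, 0 < b i) {i₀ : ι} (hi₀ : ∀ i, b i₀ ≤ b i) :
    ∃ J : Finset ι, J.card = k ∧ i₀ ∉ J ∧
      ∀ s : Finset ι, s.card = k → ∏ i ∈ s, b i ≤ ∏ i ∈ J, b i := by
  have hne : ((Finset.univ.erase i₀).powersetCard k).Nonempty := by
    rw [Finset.powersetCard_nonempty, Finset.card_erase_of_mem (Finset.mem_univ _),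
      Finset.card_univ]
    omega
  obtain ⟨J, hJ, hmax⟩ := Finset.exists_max_image _ (fun s => ∏ i ∈ s, b i) hne
  rw [Finset.mem_powersetCard] at hJ
  refine ⟨J, hJ.2, fun h => by simpa using hJ.1 h, fun s hs => ?_⟩
  -- Exchange `i₀` for an index outside `s`.
  by_cases h0 : i₀ ∈ s
  · obtain ⟨j, hj⟩ : ∃ j, j ∉ s := by
      by_contra! h
      rw [Finset.eq_univ_iff_forall.2 h, Finset.card_univ] at hs
      omega
    have hj' : j ∉ s.erase i₀ := fun h => hj (Finset.mem_of_mem_erase h)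
    have hj0 : j ≠ i₀ := fun h => hj (h ▸ h0)
    refine le_trans ?_ (hmax (insert j (s.erase i₀)) ?_)
    · rw [Finset.prod_insert hj', ← Finset.mul_prod_erase s b h0]
      exact mul_le_mul_of_nonneg_right (hi₀ j) (Finset.prod_nonneg fun i _ => (hb i).le)
    · rw [Finset.mem_powersetCard, Finset.card_insert_of_notMem hj',
        Finset.card_erase_add_one h0]
      refine ⟨fun i hi => ?_, hs⟩
      rcases Finset.mem_insert.1 hi with rfl | hi
      · simp [hj0]
      · simp [(Finset.mem_erase.1 hi).1]
  · refine hmax s (Finset.mem_powersetCard.2 ⟨fun i hi => ?_, hs⟩)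
    simp only [Finset.mem_erase, Finset.mem_univ, and_true]
    rintro rfl
    exact h0 hi

/-! ### Orthonormal axes of a norm -/

/-- The family is chosen greedily: each vector minimizes `N` on the unit sphere of the orthogonal
complement of its predecessors. Removing the components along the first `j` vectors then costs at
most a factor `2 ^ j`. -/
theorem exists_orthonormal_family {V : Type*} [NormedAddCommGroup V] [InnerProductSpace ℝ V]
    [FiniteDimensional ℝ V] (N : Seminorm ℝ V) (hN : Continuous N) (j : ℕ)
    (hj : j ≤ Module.finrank ℝ V) :
    ∃ v : Fin j → V, Orthonormal ℝ v ∧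
      (∀ x, N (x - ∑ i, ⟪v i, x⟫ • v i) ≤ 2 ^ j * N x) ∧
      ∀ i x, N (v i) * |⟪v i, x⟫| ≤ 2 ^ j * N x := by
  induction j with
  | zero => exact ⟨Fin.elim0, by simp [Orthonormal], by simp, fun i => i.elim0⟩
  | succ j ih =>
    obtain ⟨v, hv, h1, h2⟩ := ih (by omega)
    set S : Submodule ℝ V := (Submodule.span ℝ (Set.range v))ᗮ with hS
    have hSpos : 0 < Module.finrank ℝ S := by
      have e1 := Submodule.finrank_add_finrank_orthogonal (Submodule.span ℝ (Set.range v))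
      have e2 := finrank_span_eq_card hv.linearIndependent
      rw [Fintype.card_fin] at e2
      rw [hS]
      omega
    have hnt : Nontrivial S := Module.finrank_pos_iff.1 hSpos
    obtain ⟨e, heS, hmin⟩ := (isCompact_sphere (0 : S) 1).exists_isMinOn
      (NormedSpace.sphere_nonempty.2 zero_le_one)
      (hN.comp continuous_subtype_val).continuousOn
    have he1 : ‖(e : V)‖ = 1 := by simpa using heS
    have hort : ∀ i, ⟪v i, (e : V)⟫ = 0 := fun i =>
      (Submodule.mem_orthogonal _ _).1 e.2 _ (Submodule.subset_span ⟨i, rfl⟩)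
    have hle : ∀ y ∈ S, N e * ‖y‖ ≤ N y := by
      intro y hy
      rcases eq_or_ne y 0 with rfl | hy0
      · simp
      have hn : 0 < ‖y‖ := norm_pos_iff.2 hy0
      have := hmin (a := ‖y‖⁻¹ • (⟨y, hy⟩ : S)) (by simp [norm_smul, hn.ne'])
      have h3 : N e ≤ N (‖y‖⁻¹ • y) := this
      rw [map_smul_eq_mul, Real.norm_of_nonneg (by positivity)] at h3
      calc N e * ‖y‖ ≤ ‖y‖⁻¹ * N y * ‖y‖ := by gcongr
        _ = N y := by field_simp
    have hxS : ∀ x, x - ∑ i, ⟪v i, x⟫ • v i ∈ S := by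
      intro x
      rw [hS, Submodule.mem_orthogonal]
      intro w hw
      induction hw using Submodule.span_induction with
      | mem w hw =>
        obtain ⟨i, rfl⟩ := hw
        rw [inner_sub_right, hv.inner_right_fintype, sub_self]
      | zero => simp
      | add a b _ _ ha hb => rw [inner_add_left, ha, hb, add_zero]
      | smul c a _ ha => rw [real_inner_smul_left, ha, mul_zero]
    have hex : ∀ x, ⟪(e : V), x - ∑ i, ⟪v i, x⟫ • v i⟫ = ⟪(e : V), x⟫ := by
      intro x
      rw [inner_sub_right, inner_sum, Finset.sum_eq_zero, sub_zero]
      intro i _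
      rw [real_inner_smul_right, real_inner_comm (v i), hort, mul_zero]
    have hNe : ∀ x, N e * |⟪(e : V), x⟫| ≤ 2 ^ j * N x := by
      intro x
      refine le_trans ?_ ((hle _ (hxS x)).trans (h1 x))
      refine mul_le_mul_of_nonneg_left ?_ (apply_nonneg N _)
      rw [← hex x]
      simpa [he1] using abs_real_inner_le_norm (e : V) (x - ∑ i, ⟪v i, x⟫ • v i)
    have hNx : ∀ x, (2 : ℝ) ^ j * N x ≤ 2 ^ (j + 1) * N x := fun x =>
      mul_le_mul_of_nonneg_right (pow_le_pow_right₀ one_le_two (Nat.le_succ j)) (apply_nonneg N x)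
    refine ⟨Fin.snoc v (e : V), ?_, ?_, ?_⟩
    · rw [orthonormal_iff_ite]
      intro i i'
      rw [orthonormal_iff_ite] at hv
      induction i using Fin.lastCases with
      | last =>
        induction i' using Fin.lastCases with
        | last => simp [he1]
        | cast i' => simp [real_inner_comm (v i'), hort, (Fin.castSucc_lt_last i').ne']
      | cast i =>
        induction i' using Fin.lastCases with
        | last => simp [hort, (Fin.castSucc_lt_last i).ne]
        | cast i' => simp [hv i i']
    · intro x
      rw [Fin.sum_univ_castSucc]
      simp only [Fin.snoc_castSucc, Fin.snoc_last]
      rw [← sub_sub]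
      refine (map_sub_le_add N _ _).trans ?_
      rw [map_smul_eq_mul, Real.norm_eq_abs]
      have := h1 x
      have := hNe x
      rw [pow_succ]
      linarith
    · intro i x
      induction i using Fin.lastCases with
      | last => simpa using (hNe x).trans (hNx x)
      | cast i => simpa using (h2 i x).trans (hNx x)

theorem exists_orthonormal_axes {n : ℕ} (N : Seminorm ℝ (E n)) (hN : Continuous N) :
    ∃ e : OrthonormalBasis (Fin (n + 1)) ℝ (E n),
      ∀ i x, N (e i) * |⟪e i, x⟫| ≤ 2 ^ (n + 1) * N x := by
  have hfin : Module.finrank ℝ (E n) = n + 1 := finrank_euclideanSpace_fin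
  obtain ⟨v, hv, -, h2⟩ := exists_orthonormal_family N hN (n + 1) hfin.ge
  have hcard : Fintype.card (Fin (n + 1)) = Module.finrank ℝ (E n) := by simp
  refine ⟨(basisOfOrthonormalOfCardEqFinrank hv hcard).toOrthonormalBasis
    (by simpa using hv), fun i x => ?_⟩
  simpa using h2 i x

/-! ### Derivatives along lines -/

section Lines

variable {V : Type*} [NormedAddCommGroup V] [NormedSpace ℝ V]

theorem hasDerivAt_line (X v : V) (t : ℝ) : HasDerivAt (fun s : ℝ => X + s • v) v t := by
  simpa using ((hasDerivAt_id t).smul_const v).const_add X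

theorem hasDerivAt_comp_line {G : Type*} [NormedAddCommGroup G] [NormedSpace ℝ G] {f : V → G}
    {f' : V →L[ℝ] G} {X v : V} {t : ℝ} (hf : HasFDerivAt f f' (X + t • v)) :
    HasDerivAt (fun s : ℝ => f (X + s • v)) (f' v) t :=
  HasFDerivAt.comp_hasDerivAt (l := f) (f := fun s : ℝ => X + s • v) t hf (hasDerivAt_line X v t)

theorem hasDerivAt_comp_line_apply {f : V → V →L[ℝ] ℝ} {f' : V →L[ℝ] V →L[ℝ] ℝ} {X v : V} {t : ℝ}
    (hf : HasFDerivAt f f' (X + t • v)) (w : V) :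
    HasDerivAt (fun s : ℝ => f (X + s • v) w) (f' v w) t := by
  simpa using (hasDerivAt_comp_line hf).clm_apply (hasDerivAt_const t w)

end Lines

/-! ### The one-homogeneous extension -/

/-- The positively homogeneous extension of degree `1` of `u`. For a spherically convex `u` this is
the support function of a convex body. -/
def homExt {n : ℕ} (u : Sph n → ℝ) (X : E n) : ℝ := ‖X‖ * radExt u X

/-- The Euclidean Hessian of the one-homogeneous extension. -/
def homHess {n : ℕ} (u : Sph n → ℝ) (X : E n) : E n →L[ℝ] E n →L[ℝ] ℝ :=
  fderiv ℝ (fderiv ℝ (homExt u)) X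

/-- The matrix of the Hessian of the one-homogeneous extension in an orthonormal basis. -/
def homHessMat {n : ℕ} (u : Sph n → ℝ) (X : E n) (e : OrthonormalBasis (Fin (n + 1)) ℝ (E n)) :
    Matrix (Fin (n + 1)) (Fin (n + 1)) ℝ :=
  Matrix.of fun i j => homHess u X (e i) (e j)

/-- The radial projection of a nonzero vector to the sphere. -/
def unitVec {n : ℕ} (X : E n) (hX : X ≠ 0) : Sph n := ⟨‖X‖⁻¹ • X, by simp [norm_smul, hX]⟩

section

variable {n : ℕ} {u : Sph n → ℝ}

theorem homExt_eq {X : E n} (hX : X ≠ 0) : homExt u X = ‖X‖ * u (unitVec X hX) := by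
  rw [homExt, radExt, dif_pos hX, unitVec]

theorem unitVec_coe (x : Sph n) : unitVec (x : E n) (ne_zero_of_mem_unit_sphere x) = x := by
  ext1
  simp [unitVec]

theorem homExt_coe (x : Sph n) : homExt u (x : E n) = u x := by
  rw [homExt_eq (ne_zero_of_mem_unit_sphere x), unitVec_coe, norm_eq_of_mem_sphere, one_mul]

theorem norm_smul_unitVec (X : E n) (hX : X ≠ 0) : ‖X‖ • (unitVec X hX : E n) = X := by
  simp [unitVec, smul_smul, hX]

theorem homExt_smul_of_pos {c : ℝ} (hc : 0 < c) (X : E n) : homExt u (c • X) = c * homExt u X := by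
  rcases eq_or_ne X 0 with rfl | hX
  · simp [homExt]
  have hcX : c • X ≠ 0 := smul_ne_zero hc.ne' hX
  have h : unitVec (c • X) hcX = unitVec X hX := by
    ext1
    simp only [unitVec, norm_smul, Real.norm_of_nonneg hc.le, smul_smul]
    congr 1
    field_simp
  rw [homExt_eq hcX, homExt_eq hX, h, norm_smul, Real.norm_of_nonneg hc.le, mul_assoc]

theorem homExt_neg (heven : ∀ x, u (-x) = u x) (X : E n) : homExt u (-X) = homExt u X := by
  rcases eq_or_ne X 0 with rfl | hX
  · simp
  have h : unitVec (-X) (neg_ne_zero.2 hX) = -unitVec X hX := by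
    ext1
    simp [unitVec]
  rw [homExt_eq (neg_ne_zero.2 hX), homExt_eq hX, h, heven, norm_neg]

theorem homExt_smul (heven : ∀ x, u (-x) = u x) (c : ℝ) (X : E n) :
    homExt u (c • X) = |c| * homExt u X := by
  rcases lt_trichotomy c 0 with hc | rfl | hc
  · rw [← neg_neg c, neg_smul, homExt_neg heven, homExt_smul_of_pos (neg_pos.2 hc), neg_neg,
      abs_of_neg hc]
  · simp [homExt]
  · rw [homExt_smul_of_pos hc, abs_of_pos hc]

theorem contDiffAt_homExt (hu : ContMDiff (𝓡 n) 𝓘(ℝ, ℝ) 2 u) {X : E n} (hX : X ≠ 0) :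
    ContDiffAt ℝ 2 (homExt u) X :=
  (contDiffAt_norm ℝ hX).mul (contDiffAt_radExt hu hX)

theorem hasFDerivAt_homExt (hu : ContMDiff (𝓡 n) 𝓘(ℝ, ℝ) 2 u) {X : E n} (hX : X ≠ 0) :
    HasFDerivAt (homExt u) (fderiv ℝ (homExt u) X) X :=
  ((contDiffAt_homExt hu hX).differentiableAt two_ne_zero).hasFDerivAt

theorem contDiffAt_fderiv_homExt (hu : ContMDiff (𝓡 n) 𝓘(ℝ, ℝ) 2 u) {X : E n} (hX : X ≠ 0) :
    ContDiffAt ℝ 1 (fderiv ℝ (homExt u)) X :=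
  (contDiffAt_homExt hu hX).fderiv_right (by norm_num)

theorem hasFDerivAt_fderiv_homExt (hu : ContMDiff (𝓡 n) 𝓘(ℝ, ℝ) 2 u) {X : E n} (hX : X ≠ 0) :
    HasFDerivAt (fderiv ℝ (homExt u)) (homHess u X) X :=
  ((contDiffAt_fderiv_homExt hu hX).differentiableAt one_ne_zero).hasFDerivAt

theorem continuousAt_homHess (hu : ContMDiff (𝓡 n) 𝓘(ℝ, ℝ) 2 u) {X : E n} (hX : X ≠ 0) :
    ContinuousAt (homHess u) X :=
  ((contDiffAt_fderiv_homExt hu hX).fderiv_right (m := 0) (by norm_num)).continuousAt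

theorem homHess_comm (hu : ContMDiff (𝓡 n) 𝓘(ℝ, ℝ) 2 u) {X : E n} (hX : X ≠ 0) (v w : E n) :
    homHess u X v w = homHess u X w v :=
  (contDiffAt_homExt hu hX).isSymmSndFDerivAt (by simp) v w

theorem fderiv_homExt_smul (hu : ContMDiff (𝓡 n) 𝓘(ℝ, ℝ) 2 u) {c : ℝ} (hc : 0 < c) {X : E n}
    (hX : X ≠ 0) : fderiv ℝ (homExt u) (c • X) = fderiv ℝ (homExt u) X := by
  have h1 := (hasFDerivAt_homExt hu (smul_ne_zero hc.ne' hX)).comp X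
    ((hasFDerivAt_id X).const_smul c)
  have h2 : homExt u ∘ (HSMul.hSMul c : E n → E n) = fun Y => c * homExt u Y := by
    funext Y
    exact homExt_smul_of_pos hc Y
  rw [h2] at h1
  have h3 := h1.unique ((hasFDerivAt_homExt hu hX).const_mul c)
  ext v
  have h4 := congrArg (fun T : E n →L[ℝ] ℝ => T v) h3
  simpa [hc.ne'] using h4

theorem smul_homHess_smul (hu : ContMDiff (𝓡 n) 𝓘(ℝ, ℝ) 2 u) {c : ℝ} (hc : 0 < c) {X : E n}
    (hX : X ≠ 0) : c • homHess u (c • X) = homHess u X := by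
  have h1 := (hasFDerivAt_fderiv_homExt hu (smul_ne_zero hc.ne' hX)).comp X
    ((hasFDerivAt_id X).const_smul c)
  have h2 : fderiv ℝ (homExt u) ∘ (HSMul.hSMul c : E n → E n) =ᶠ[nhds X] fderiv ℝ (homExt u) := by
    filter_upwards [isOpen_compl_singleton.mem_nhds hX] with Y hY
    exact fderiv_homExt_smul hu hc hY
  have h3 := (h1.congr_of_eventuallyEq h2.symm).unique (hasFDerivAt_fderiv_homExt hu hX)
  rw [← h3]
  ext v w
  simp

theorem homHess_self (hu : ContMDiff (𝓡 n) 𝓘(ℝ, ℝ) 2 u) {X : E n} (hX : X ≠ 0) :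
    homHess u X X = 0 := by
  have hl : HasDerivAt (fun s : ℝ => s • X) ((1 : ℝ) • X) 1 := (hasDerivAt_id (1 : ℝ)).smul_const _
  have hF : HasFDerivAt (fderiv ℝ (homExt u)) (homHess u X) ((1 : ℝ) • X) := by
    rw [one_smul]
    exact hasFDerivAt_fderiv_homExt hu hX
  have h1 := hF.comp_hasDerivAt (1 : ℝ) hl
  rw [one_smul] at h1
  refine h1.unique ((hasDerivAt_const (1 : ℝ) (fderiv ℝ (homExt u) X)).congr_of_eventuallyEq ?_)
  filter_upwards [lt_mem_nhds (zero_lt_one' ℝ)] with s hs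
  exact fderiv_homExt_smul hu hs hX

/-- On tangent vectors the Hessian of the one-homogeneous extension is `∇²u + u g`. -/
theorem homHess_eq_W (hu : ContMDiff (𝓡 n) 𝓘(ℝ, ℝ) 2 u) (x : Sph n) {v w : E n} (hv : v ∈ Tan x)
    (hw : w ∈ Tan x) : homHess u x v w = W u x v w := by
  have hx1 : ‖(x : E n)‖ = 1 := norm_eq_of_mem_sphere x
  have hx0 : (x : E n) ≠ 0 := ne_zero_of_mem_unit_sphere x
  have hxv : ⟪(x : E n), v⟫ = 0 := Submodule.mem_orthogonal_singleton_iff_inner_right.1 hv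
  have hxw : ⟪(x : E n), w⟫ = 0 := Submodule.mem_orthogonal_singleton_iff_inner_right.1 hw
  have hat0 : ∀ Y z : E n, Y + (0 : ℝ) • z = Y := fun Y z => by rw [zero_smul, add_zero]
  have hnorm : ∀ Y : E n, Y ≠ 0 → ∀ z, HasDerivAt (fun t : ℝ => ‖Y + t • z‖) (⟪Y, z⟫ / ‖Y‖) 0 := by
    intro Y hY z
    have h1 := (hasDerivAt_line Y z 0).norm_sq.sqrt (by simpa using hY)
    simp only [zero_smul, add_zero, Real.sqrt_sq (norm_nonneg _)] at h1
    convert h1 using 1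
    field_simp
  have hrad : ∀ Y : E n, Y ≠ 0 → ∀ z,
      HasDerivAt (fun t : ℝ => radExt u (Y + t • z)) (fderiv ℝ (radExt u) Y z) 0 := by
    intro Y hY z
    refine hasDerivAt_comp_line ?_
    rw [hat0]
    exact ((contDiffAt_radExt hu hY).differentiableAt two_ne_zero).hasFDerivAt
  have hfd : ∀ Y : E n, Y ≠ 0 → fderiv ℝ (homExt u) Y w =
      ⟪Y, w⟫ / ‖Y‖ * radExt u Y + ‖Y‖ * fderiv ℝ (radExt u) Y w := by
    intro Y hY
    have h1 := (hnorm Y hY w).mul (hrad Y hY w)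
    simp only [hat0] at h1
    have h2 : HasDerivAt (fun t : ℝ => homExt u (Y + t • w)) (fderiv ℝ (homExt u) Y w) 0 := by
      refine hasDerivAt_comp_line ?_
      rw [hat0]
      exact hasFDerivAt_homExt hu hY
    exact h2.unique h1
  have hL : HasDerivAt (fun t : ℝ => fderiv ℝ (homExt u) ((x : E n) + t • v) w)
      (homHess u x v w) 0 := by
    refine hasDerivAt_comp_line_apply ?_ w
    rw [hat0]
    exact hasFDerivAt_fderiv_homExt hu hx0
  have hR1 : HasDerivAt (fun t : ℝ => fderiv ℝ (radExt u) ((x : E n) + t • v) w)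
      (sphHess u x v w) 0 := by
    refine hasDerivAt_comp_line_apply (f' := fderiv ℝ (fderiv ℝ (radExt u)) x) ?_ w
    rw [hat0]
    exact (((contDiffAt_radExt hu hx0).fderiv_right (m := 1) (by norm_num)).differentiableAt
      one_ne_zero).hasFDerivAt
  have hR2 : HasDerivAt (fun t : ℝ => ⟪(x : E n) + t • v, w⟫) ⟪v, w⟫ 0 := by
    simpa using (hasDerivAt_line (x : E n) v 0).inner ℝ (hasDerivAt_const (0 : ℝ) w)
  have hR := ((hR2.div (hnorm x hx0 v) (by simp [hx1])).mul (hrad x hx0 v)).add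
    ((hnorm x hx0 v).mul hR1)
  have hev : (fun t : ℝ => fderiv ℝ (homExt u) ((x : E n) + t • v) w) =ᶠ[nhds 0] fun t =>
      ⟪(x : E n) + t • v, w⟫ / ‖(x : E n) + t • v‖ * radExt u ((x : E n) + t • v) +
        ‖(x : E n) + t • v‖ * fderiv ℝ (radExt u) ((x : E n) + t • v) w := by
    have : ∀ᶠ t : ℝ in nhds 0, (x : E n) + t • v ≠ 0 :=
      (hasDerivAt_line (x : E n) v 0).continuousAt.eventually_ne (by simpa using hx0)
    filter_upwards [this] with t ht
    exact hfd _ ht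
  have := hL.unique (hR.congr_of_eventuallyEq hev)
  have hr : radExt u (x : E n) = u x := by
    have := homExt_coe (u := u) x
    rwa [homExt, hx1, one_mul] at this
  rw [this, W]
  simp [hx1, hxv, hxw, hr]
  ring

theorem homHess_nonneg (hu : ContMDiff (𝓡 n) 𝓘(ℝ, ℝ) 2 u) (hconv : SphericallyConvex u) {X : E n}
    (hX : X ≠ 0) (v : E n) : 0 ≤ homHess u X v v := by
  set x := unitVec X hX with hx
  have hx0 : (x : E n) ≠ 0 := ne_zero_of_mem_unit_sphere x
  have hx1 : ‖(x : E n)‖ = 1 := norm_eq_of_mem_sphere x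
  have hn : 0 < ‖X‖ := norm_pos_iff.2 hX
  have h1 : ‖X‖ • homHess u X = homHess u x := by
    have := smul_homHess_smul hu hn hx0
    rwa [hx, norm_smul_unitVec] at this
  set w := v - ⟪(x : E n), v⟫ • (x : E n) with hw
  have hwT : w ∈ Tan x := by
    rw [Submodule.mem_orthogonal_singleton_iff_inner_right, hw, inner_sub_right,
      real_inner_smul_right, real_inner_self_eq_norm_sq, hx1]
    ring
  have hv : v = w + ⟪(x : E n), v⟫ • (x : E n) := by rw [hw, sub_add_cancel]
  have h2 : homHess u x v v = homHess u x w w := by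
    have hk := homHess_self hu hx0
    have hk' : homHess u x w x = 0 := by rw [homHess_comm hu hx0, hk]; rfl
    rw [hv]
    generalize ⟪(x : E n), v⟫ = c
    simp [hk, hk']
  have h3 : 0 ≤ ‖X‖ * homHess u X v v := by
    have : ‖X‖ * homHess u X v v = homHess u x v v := by rw [← h1]; rfl
    rw [this, h2, homHess_eq_W hu x hwT hwT]
    exact hconv x w hwT
  exact nonneg_of_mul_nonneg_right h3 hn

theorem homHessMat_quadForm (X : E n) (e : OrthonormalBasis (Fin (n + 1)) ℝ (E n))
    (v : Fin (n + 1) → ℝ) : v ⬝ᵥ (homHessMat u X e).mulVec v =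
      homHess u X (∑ i, v i • e i) (∑ i, v i • e i) := by
  simp only [homHessMat, dotProduct, Matrix.mulVec, Matrix.of_apply, map_sum, map_smul,
    sum_apply, smul_apply, smul_eq_mul, Finset.mul_sum]
  exact Finset.sum_comm.trans
    (Finset.sum_congr rfl fun i _ => Finset.sum_congr rfl fun j _ => by ring)

theorem homHessMat_posSemidef (hu : ContMDiff (𝓡 n) 𝓘(ℝ, ℝ) 2 u) (hconv : SphericallyConvex u)
    {X : E n} (hX : X ≠ 0) (e : OrthonormalBasis (Fin (n + 1)) ℝ (E n)) :
    (homHessMat u X e).PosSemidef := by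
  refine Matrix.PosSemidef.of_dotProduct_mulVec_nonneg ?_ fun v => ?_
  · ext i j
    simpa [homHessMat] using homHess_comm hu hX (e j) (e i)
  · rw [star_trivial, homHessMat_quadForm]
    exact homHess_nonneg hu hconv hX _

theorem exists_orthonormalBasis_cons (x : Sph n) : ∃ c : OrthonormalBasis (Fin (n + 1)) ℝ (E n),
    c 0 = x ∧ ∀ i, c (Fin.succ i) = (frame x i : E n) := by
  have ho : Orthonormal ℝ (Fin.cons (x : E n) fun i => (frame x i : E n) : Fin (n + 1) → E n) := by
    have hf := (frame x).orthonormal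
    rw [orthonormal_iff_ite] at hf ⊢
    have hxf : ∀ i, ⟪(x : E n), (frame x i : E n)⟫ = 0 := fun i =>
      Submodule.mem_orthogonal_singleton_iff_inner_right.1 (frame x i).2
    intro i j
    induction i using Fin.cases with
    | zero =>
      induction j using Fin.cases with
      | zero => simp
      | succ j => simpa [(Fin.succ_ne_zero j).symm] using hxf j
    | succ i =>
      induction j using Fin.cases with
      | zero =>
        simp only [Fin.cons_succ, Fin.cons_zero, Fin.succ_ne_zero, if_false]
        rw [real_inner_comm]
        exact hxf i
      | succ j => simpa using hf i j
  have hcard : Fintype.card (Fin (n + 1)) = Module.finrank ℝ (E n) := by simp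
  refine ⟨(basisOfOrthonormalOfCardEqFinrank ho hcard).toOrthonormalBasis (by simpa using ho),
    by simp, fun i => by simp⟩

/-- The equation in terms of the one-homogeneous extension: its Hessian has the eigenvalues of
`∇²u + u g`, scaled by homogeneity, together with the eigenvalue `0` in the radial direction. -/
theorem sigmaW_unitVec (hu : ContMDiff (𝓡 n) 𝓘(ℝ, ℝ) 2 u) {k : ℕ} (hk : k ≤ n) {X : E n}
    (hX : X ≠ 0) (e : OrthonormalBasis (Fin (n + 1)) ℝ (E n)) :
    sigmaW k u (unitVec X hX) = ‖X‖ ^ k * sigma k (homHessMat u X e) := by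
  set x := unitVec X hX with hx
  have hx0 : (x : E n) ≠ 0 := ne_zero_of_mem_unit_sphere x
  have hn : 0 < ‖X‖ := norm_pos_iff.2 hX
  obtain ⟨c, hc0, hcs⟩ := exists_orthonormalBasis_cons x
  have h1 : homHessMat u x e = ‖X‖ • homHessMat u X e := by
    have := smul_homHess_smul hu hn hx0
    rw [hx, norm_smul_unitVec] at this
    ext i j
    rw [homHessMat, Matrix.of_apply, hx, ← this]
    rfl
  rw [← sigma_smul, ← h1]
  have h2 : sigma k (homHessMat u x c) = sigma k (homHessMat u x e) := by
    set P : Matrix (Fin (n + 1)) (Fin (n + 1)) ℝ := e.toBasis.toMatrix c with hP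
    have hO : P ∈ Matrix.orthogonalGroup (Fin (n + 1)) ℝ :=
      e.toMatrix_orthonormalBasis_mem_orthogonal c
    have hW : homHessMat u x c = P.transpose * homHessMat u x e * P := by
      ext i j
      have hb : ∀ i, c i = ∑ l, P l i • e l := by
        intro i
        have := e.toBasis.sum_toMatrix_smul_self c i
        rw [← this]
        simp [hP]
      simp only [homHessMat, Matrix.of_apply, Matrix.mul_apply, Matrix.transpose_apply]
      rw [hb i, hb j]
      simp only [map_sum, map_smul, sum_apply, smul_apply, smul_eq_mul, Finset.sum_mul,
        Finset.mul_sum]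
      exact Finset.sum_congr rfl fun i _ => Finset.sum_congr rfl fun j _ => by ring
    rw [hW, sigma_orthogonal_conj (by simp; omega) _ hO]
  rw [← h2, ← sigma_submatrix_succ hk, sigmaW]
  · congr 1
    ext i j
    simp [homHessMat, hcs, Wmat, homHess_eq_W hu x (frame x i).2 (frame x j).2]
  · intro j
    rw [homHessMat, Matrix.of_apply, hc0, homHess_self hu hx0]
    rfl

/-- Along segments avoiding the origin the convexity of the extension is read off its Hessian; a
pair of linearly dependent vectors reduces to homogeneity and evenness. -/
theorem homExt_add_le (hu : ContMDiff (𝓡 n) 𝓘(ℝ, ℝ) 2 u) (hpos : ∀ x, 0 < u x)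
    (heven : ∀ x, u (-x) = u x) (hconv : SphericallyConvex u) (X Y : E n) :
    homExt u (X + Y) ≤ homExt u X + homExt u Y := by
  have hnn : ∀ Z, 0 ≤ homExt u Z := by
    intro Z
    rcases eq_or_ne Z 0 with rfl | hZ
    · simp [homExt]
    · rw [homExt_eq hZ]
      exact mul_nonneg (norm_nonneg _) (hpos _).le
  rcases eq_or_ne X 0 with rfl | hX
  · simp [homExt]
  by_cases hdep : ∃ c : ℝ, Y = c • X
  · obtain ⟨c, rfl⟩ := hdep
    have : X + c • X = (1 + c) • X := by rw [add_smul, one_smul]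
    rw [this, homExt_smul heven, homExt_smul heven, ← one_add_mul]
    refine mul_le_mul_of_nonneg_right ?_ (hnn X)
    simpa using abs_add_le 1 c
  push Not at hdep
  have hne : ∀ t : ℝ, X + t • (Y - X) ≠ 0 := by
    intro t ht
    rcases eq_or_ne t 0 with rfl | h0
    · simp [hX] at ht
    · refine hdep (1 - t⁻¹) ?_
      have : t⁻¹ • (X + t • (Y - X)) = 0 := by rw [ht, smul_zero]
      rw [smul_add, smul_smul, inv_mul_cancel₀ h0, one_smul] at this
      rw [sub_smul, one_smul, ← sub_eq_zero, ← this]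
      abel
  have hd1 : ∀ t : ℝ, HasDerivAt (fun t => homExt u (X + t • (Y - X)))
      (fderiv ℝ (homExt u) (X + t • (Y - X)) (Y - X)) t := fun t =>
    hasDerivAt_comp_line (hasFDerivAt_homExt hu (hne t))
  have hd2 : ∀ t : ℝ, HasDerivAt (fun t => fderiv ℝ (homExt u) (X + t • (Y - X)) (Y - X))
      (homHess u (X + t • (Y - X)) (Y - X) (Y - X)) t := fun t =>
    hasDerivAt_comp_line_apply (hasFDerivAt_fderiv_homExt hu (hne t)) _
  have hder : deriv (fun t => homExt u (X + t • (Y - X))) =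
      fun t => fderiv ℝ (homExt u) (X + t • (Y - X)) (Y - X) := funext fun t => (hd1 t).deriv
  have hcvx : ConvexOn ℝ Set.univ fun t : ℝ => homExt u (X + t • (Y - X)) := by
    refine convexOn_univ_of_deriv2_nonneg (fun t => (hd1 t).differentiableAt) ?_ fun t => ?_
    · rw [hder]
      exact fun t => (hd2 t).differentiableAt
    · rw [Function.iterate_succ, Function.iterate_one, Function.comp, hder, (hd2 t).deriv]
      exact homHess_nonneg hu hconv (hne t) _
  have h := hcvx.2 (Set.mem_univ 0) (Set.mem_univ 1) (by norm_num : (0 : ℝ) ≤ 1 / 2)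
    (by norm_num : (0 : ℝ) ≤ 1 / 2) (by norm_num)
  have hmid : X + ((1 / 2 : ℝ) • (0 : ℝ) + (1 / 2 : ℝ) • (1 : ℝ)) • (Y - X) =
      (1 / 2 : ℝ) • (X + Y) := by
    rw [smul_zero, zero_add, smul_eq_mul, mul_one, smul_sub, smul_add]
    have : X = (1 / 2 : ℝ) • X + (1 / 2 : ℝ) • X := by rw [← add_smul]; norm_num
    nth_rewrite 1 [this]
    abel
  simp only [hmid] at h
  rw [homExt_smul heven, abs_of_pos (by norm_num)] at h
  simp at h
  linarith

theorem continuous_homExt (hu : ContMDiff (𝓡 n) 𝓘(ℝ, ℝ) 2 u) : Continuous (homExt u) := by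
  rw [continuous_iff_continuousAt]
  intro X
  rcases eq_or_ne X 0 with rfl | hX
  · obtain ⟨M, hM⟩ := (isCompact_range hu.continuous).isBounded.exists_norm_le
    have hb : ∀ X : E n, ‖homExt u X‖ ≤ ‖X‖ * M := by
      intro X
      rcases eq_or_ne X 0 with rfl | hX
      · simp [homExt]
      · rw [homExt_eq hX, norm_mul, norm_norm]
        exact mul_le_mul_of_nonneg_left (hM _ ⟨_, rfl⟩) (norm_nonneg _)
    have h0 : homExt u (0 : E n) = 0 := by simp [homExt]
    rw [ContinuousAt, h0]
    refine squeeze_zero_norm hb ?_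
    have : Filter.Tendsto (fun X : E n => ‖X‖ * M) (nhds 0) (nhds (‖(0 : E n)‖ * M)) :=
      (continuous_norm.mul continuous_const).tendsto 0
    simpa using this
  · exact (contDiffAt_homExt hu hX).continuousAt

/-- The one-homogeneous extension as a seminorm. -/
def homSeminorm (hu : ContMDiff (𝓡 n) 𝓘(ℝ, ℝ) 2 u) (hpos : ∀ x, 0 < u x)
    (heven : ∀ x, u (-x) = u x) (hconv : SphericallyConvex u) : Seminorm ℝ (E n) :=
  Seminorm.of (homExt u) (homExt_add_le hu hpos heven hconv) fun c X => homExt_smul heven c X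

end

/-! ### A point with small second derivatives -/

section

variable {n : ℕ} {u : Sph n → ℝ}

theorem homExt_pos (hpos : ∀ x, 0 < u x) {X : E n} (hX : X ≠ 0) : 0 < homExt u X := by
  rw [homExt_eq hX]
  exact mul_pos (norm_pos_iff.2 hX) (hpos _)

/-- A seminorm is Lipschitz with respect to itself, which bounds its derivative. -/
theorem abs_fderiv_homExt_le (hu : ContMDiff (𝓡 n) 𝓘(ℝ, ℝ) 2 u) (hpos : ∀ x, 0 < u x)
    (heven : ∀ x, u (-x) = u x) (hconv : SphericallyConvex u) {X : E n} (hX : X ≠ 0) (v : E n) :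
    |fderiv ℝ (homExt u) X v| ≤ homExt u v := by
  set N := homSeminorm hu hpos heven hconv
  have h1 : HasDerivAt (fun t : ℝ => homExt u (X + t • v)) (fderiv ℝ (homExt u) X v) 0 := by
    refine hasDerivAt_comp_line ?_
    rw [zero_smul, add_zero]
    exact hasFDerivAt_homExt hu hX
  have h2 := h1.hasFDerivAt.le_of_lip' (C := homExt u v) (apply_nonneg N v)
    (Filter.Eventually.of_forall fun t => by
      have h3 : ‖N (X + t • v) - N (X + (0 : ℝ) • v)‖ ≤ N ((X + t • v) - (X + (0 : ℝ) • v)) := by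
        rw [Real.norm_eq_abs]
        exact abs_sub_map_le_sub N _ _
      refine h3.trans (le_of_eq ?_)
      have h4 : (X + t • v) - (X + (0 : ℝ) • v) = t • v := by simp
      rw [h4, map_smul_eq_mul, sub_zero, mul_comm]
      rfl)
  simpa using h2

/-- Averaging over the cube `[1, 2]^{n+1}`: by the divergence theorem and the gradient bound, the
mean of `∑ᵢ ∂ᵢᵢ N / N(eᵢ)` is at most the number of faces. -/
theorem exists_homHess_diag_le (hu : ContMDiff (𝓡 n) 𝓘(ℝ, ℝ) 2 u) (hpos : ∀ x, 0 < u x)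
    (heven : ∀ x, u (-x) = u x) (hconv : SphericallyConvex u)
    (e : OrthonormalBasis (Fin (n + 1)) ℝ (E n)) :
    ∃ y : Fin (n + 1) → ℝ, (∀ i, 1 ≤ y i ∧ y i ≤ 2) ∧
      ∀ j, homHess u (∑ i, y i • e i) (e j) (e j) ≤ 2 * (n + 1) * homExt u (e j) := by
  set X : (Fin (n + 1) → ℝ) →L[ℝ] E n :=
    ∑ i, (ContinuousLinearMap.proj (R := ℝ) (φ := fun _ : Fin (n + 1) => ℝ) i).smulRight (e i)
    with hXdef
  have hX : ∀ y, X y = ∑ i, y i • e i := by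
    intro y
    simp [hXdef]
  have hXs : ∀ i, X (Pi.single i 1) = e i := by
    intro i
    rw [hX, Finset.sum_eq_single i] <;> simp +contextual
  have hX0 : ∀ y ∈ Set.Icc (1 : Fin (n + 1) → ℝ) 2, X y ≠ 0 := by
    intro y hy h
    have h1 : ⟪e 0, X y⟫ = y 0 := by rw [hX, e.orthonormal.inner_right_fintype]
    rw [h, inner_zero_right] at h1
    have := hy.1 0
    simp only [Pi.one_apply] at this
    linarith
  have hb : ∀ i, 0 < homExt u (e i) := fun i => homExt_pos hpos (e.orthonormal.ne_zero i)
  set F : Fin (n + 1) → (Fin (n + 1) → ℝ) → ℝ :=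
    fun i y => (homExt u (e i))⁻¹ * fderiv ℝ (homExt u) (X y) (e i) with hF
  set F' : Fin (n + 1) → (Fin (n + 1) → ℝ) → (Fin (n + 1) → ℝ) →L[ℝ] ℝ :=
    fun i y => (homExt u (e i))⁻¹ • ((homHess u (X y)).flip (e i)).comp X with hF'
  have hderiv : ∀ y ∈ Set.Icc (1 : Fin (n + 1) → ℝ) 2, ∀ i, HasFDerivAt (F i) (F' i y) y := by
    intro y hy i
    have h1 := (hasFDerivAt_fderiv_homExt hu (hX0 y hy)).comp y X.hasFDerivAt
    have h2 := (((ContinuousLinearMap.apply ℝ ℝ (e i)).hasFDerivAt.comp y h1).const_mul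
      (homExt u (e i))⁻¹)
    exact h2
  have hbound : ∀ y ∈ Set.Icc (1 : Fin (n + 1) → ℝ) 2, ∀ i, ‖F i y‖ ≤ 1 := by
    intro y hy i
    rw [hF, norm_mul, norm_inv, Real.norm_of_nonneg (hb i).le, Real.norm_eq_abs,
      inv_mul_le_iff₀ (hb i), mul_one]
    exact abs_fderiv_homExt_le hu hpos heven hconv (hX0 y hy) _
  set D : (Fin (n + 1) → ℝ) → ℝ := fun y => ∑ i, F' i y (Pi.single i 1) with hD
  have hDeq : ∀ y, D y = ∑ i, (homExt u (e i))⁻¹ * homHess u (X y) (e i) (e i) := by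
    intro y
    simp [hD, hF', hXs]
  have hDcont : ContinuousOn D (Set.Icc 1 2) := by
    intro y hy
    have h1 : ContinuousAt (fun y => homHess u (X y)) y :=
      (continuousAt_homHess hu (hX0 y hy)).comp X.continuous.continuousAt
    have h2 : ContinuousAt (fun y => ∑ i, (homExt u (e i))⁻¹ * homHess u (X y) (e i) (e i)) y := by
      fun_prop
    exact (h2.congr (Filter.Eventually.of_forall fun y => (hDeq y).symm)).continuousWithinAt
  have hDint : MeasureTheory.IntegrableOn D (Set.Icc 1 2) :=
    hDcont.integrableOn_compact isCompact_Icc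
  have hvol : ∀ m : ℕ, MeasureTheory.volume (Set.Icc (1 : Fin m → ℝ) 2) = 1 := by
    intro m
    rw [Real.volume_Icc_pi]
    simp only [Pi.ofNat_apply]
    norm_num
  have hdiv := MeasureTheory.integral_divergence_of_hasFDerivAt_off_countable'
    (1 : Fin (n + 1) → ℝ) 2 (fun i => by norm_num) F F' ∅ Set.countable_empty
    (fun i y hy => (hderiv y hy i).continuousAt.continuousWithinAt)
    (fun y hy i => hderiv y ⟨fun j => (hy.1 j trivial).1.le, fun j => (hy.1 j trivial).2.le⟩ i) hDint
  have hface : ∀ (i : Fin (n + 1)) (c : ℝ), 1 ≤ c → c ≤ 2 →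
      ‖∫ x in Set.Icc ((1 : Fin (n + 1) → ℝ) ∘ i.succAbove) ((2 : Fin (n + 1) → ℝ) ∘ i.succAbove),
        F i (i.insertNth (α := fun _ => ℝ) c x)‖ ≤ 1 := by
    intro i c hc1 hc2
    have h1 : (1 : Fin (n + 1) → ℝ) ∘ i.succAbove = 1 := rfl
    have h2 : (2 : Fin (n + 1) → ℝ) ∘ i.succAbove = 2 := rfl
    rw [h1, h2]
    refine (MeasureTheory.norm_setIntegral_le_of_norm_le_const (C := 1)
      (by rw [hvol]; exact ENNReal.one_lt_top) fun x hx => hbound _ ?_ i).trans (le_of_eq ?_)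
    · rw [Fin.insertNth_mem_Icc]
      exact ⟨⟨hc1, hc2⟩, hx⟩
    · simp [MeasureTheory.measureReal_def, hvol]
  have hle : ∫ y in Set.Icc (1 : Fin (n + 1) → ℝ) 2, D y ≤ 2 * (n + 1) := by
    refine hdiv.trans_le ((Finset.sum_le_card_nsmul _ _ 2 fun i _ => ?_).trans (le_of_eq ?_))
    · have h1 := hface i 2 one_le_two le_rfl
      have h2 := hface i 1 le_rfl one_le_two
      rw [Real.norm_eq_abs] at h1 h2
      have h3 := abs_le.1 h1
      have h4 := abs_le.1 h2
      exact (sub_le_sub h3.2 h4.1).trans (by norm_num)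
    · simp
      ring
  obtain ⟨y, hy, hyD⟩ := MeasureTheory.exists_le_setAverage (μ := MeasureTheory.volume)
    (s := Set.Icc (1 : Fin (n + 1) → ℝ) 2) (f := D) (by rw [hvol]; exact one_ne_zero)
    (by rw [hvol]; exact ENNReal.one_ne_top) hDint
  rw [MeasureTheory.setAverage_eq, MeasureTheory.measureReal_def, hvol, ENNReal.toReal_one, inv_one,
    one_smul] at hyD
  refine ⟨y, fun i => ⟨hy.1 i, hy.2 i⟩, fun j => ?_⟩
  rw [← hX]
  have h1 : (homExt u (e j))⁻¹ * homHess u (X y) (e j) (e j) ≤ D y := by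
    rw [hDeq]
    exact Finset.single_le_sum
      (f := fun i => (homExt u (e i))⁻¹ * homHess u (X y) (e i) (e i))
      (fun i _ => mul_nonneg (inv_nonneg.2 (hb i).le) (homHess_nonneg hu hconv (hX0 y hy) _))
      (Finset.mem_univ j)
  have h2 := (h1.trans hyD).trans hle
  rwa [inv_mul_le_iff₀ (hb j), mul_comm] at h2

end

/-! ### A point with large second derivatives -/

/-- The second-order necessary condition: if the second derivative were negative, the point would
also be a local maximum, so `g` would be locally constant. -/
theorem deriv2_nonneg_of_isLocalMin {g g' : ℝ → ℝ} {c x : ℝ} (hg : ∀ t, HasDerivAt g (g' t) t)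
    (hg' : HasDerivAt g' c x) (hmin : IsLocalMin g x) : 0 ≤ c := by
  have hder : deriv g = g' := funext fun t => (hg t).deriv
  by_contra! hc
  have hmax : IsLocalMax g x := isLocalMax_of_deriv_deriv_neg (by rwa [hder, hg'.deriv])
    hmin.deriv_eq_zero (hg x).continuousAt
  have hconst : g =ᶠ[nhds x] fun _ => g x := by
    filter_upwards [hmin, hmax] with t h1 h2
    exact le_antisymm h2 h1
  have h1 : g' =ᶠ[nhds x] fun _ => 0 := by
    have := hconst.deriv
    rwa [hder, deriv_const'] at this
  have := hg'.unique ((hasDerivAt_const x (0 : ℝ)).congr_of_eventuallyEq h1)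
  exact hc.ne this

section

variable {n : ℕ} {u : Sph n → ℝ}

/-- Touching the one-homogeneous extension `N` from below by a paraboloid, on the box
`|yⱼ| ≤ rⱼ = 2 N(e_{i₀}) / (κ N(eⱼ))` centred at `e_{i₀}`. On a face `N ≥ 2 N(e_{i₀})`, while the
paraboloid opens only by `N(e_{i₀}) / 2` over the box, so that the difference has an interior
minimum. -/
theorem exists_homHess_ge (hu : ContMDiff (𝓡 n) 𝓘(ℝ, ℝ) 2 u) (hpos : ∀ x, 0 < u x)
    (e : OrthonormalBasis (Fin (n + 1)) ℝ (E n)) {κ : ℝ} (hκ : 0 < κ)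
    (haxes : ∀ i x, κ * homExt u (e i) * |⟪e i, x⟫| ≤ homExt u x)
    {J : Finset (Fin (n + 1))} (hJ : J.Nonempty) {i₀ : Fin (n + 1)} (hi₀ : i₀ ∉ J) :
    ∃ y : J → ℝ, (∀ j, |y j| ≤ 2 * homExt u (e i₀) / (κ * homExt u (e j))) ∧
      ∀ v : J → ℝ, ∑ j : J, κ ^ 2 * homExt u (e j) ^ 2 / (4 * J.card * homExt u (e i₀)) * v j ^ 2 ≤
        homHess u (e i₀ + ∑ j : J, y j • e j) (∑ j : J, v j • e j) (∑ j : J, v j • e j) := by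
  set m := homExt u (e i₀) with hm
  have hb : ∀ i, 0 < homExt u (e i) := fun i => homExt_pos hpos (e.orthonormal.ne_zero i)
  have hm0 : 0 < m := hb i₀
  have hk : (0 : ℝ) < J.card := by exact_mod_cast hJ.card_pos
  set r : J → ℝ := fun j => 2 * m / (κ * homExt u (e j)) with hr
  have hr0 : ∀ j, 0 < r j := fun j => div_pos (by positivity) (mul_pos hκ (hb j))
  set q : J → ℝ := fun j => κ ^ 2 * homExt u (e j) ^ 2 / (8 * J.card * m) with hq
  have hqr : ∀ j, q j * r j ^ 2 = m / (2 * J.card) := by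
    intro j
    have := (hb j).ne'
    simp only [hq, hr]
    field_simp
    norm_num
  have hq0 : ∀ j, 0 ≤ q j := fun j => by simp only [hq]; positivity
  set X : (J → ℝ) → E n := fun y => e i₀ + ∑ j : J, y j • e j with hX
  have hXi : ∀ y, ⟪e i₀, X y⟫ = 1 := by
    intro y
    rw [hX, inner_add_right, inner_sum, Finset.sum_eq_zero, add_zero]
    · simp
    · intro j _
      rw [real_inner_smul_right, e.inner_eq_zero fun h => hi₀ (by rw [h]; exact j.2), mul_zero]
  have hXj : ∀ y (j : J), ⟪e j, X y⟫ = y j := by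
    intro y j
    have hj : (j : Fin (n + 1)) ≠ i₀ := fun h => hi₀ (h ▸ j.2)
    rw [hX, inner_add_right, e.inner_eq_zero hj, zero_add, inner_sum, Finset.sum_eq_single j]
    · rw [real_inner_smul_right, e.inner_eq_one, mul_one]
    · intro l _ hl
      rw [real_inner_smul_right, e.inner_eq_zero fun h => hl (Subtype.ext h.symm), mul_zero]
    · simp
  have hX0 : ∀ y, X y ≠ 0 := by
    intro y h
    have := hXi y
    rw [h, inner_zero_right] at this
    exact zero_ne_one this
  have hXc : Continuous X := by simp only [hX]; fun_prop
  set ψ : (J → ℝ) → ℝ := fun y => homExt u (X y) - ∑ j, q j * y j ^ 2 with hψ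
  have hψc : Continuous ψ := ((continuous_homExt hu).comp hXc).sub (by fun_prop)
  obtain ⟨y, hy, hymin⟩ := (isCompact_Icc (a := -r) (b := r)).exists_isMinOn
    ⟨0, fun j => by simpa using (hr0 j).le, fun j => (hr0 j).le⟩ hψc.continuousOn
  have hyr : ∀ j, |y j| ≤ r j := fun j => abs_le.2 ⟨hy.1 j, hy.2 j⟩
  have hψ0 : ψ y ≤ m := by
    have h1 : ψ 0 = m := by simp [hψ, hX, hm]
    rw [← h1]
    exact hymin ⟨fun j => by simpa using (hr0 j).le, fun j => (hr0 j).le⟩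
  have hint : ∀ j, |y j| < r j := by
    intro j
    refine lt_of_le_of_ne (hyr j) fun hj => ?_
    have h1 : 2 * m ≤ homExt u (X y) := by
      have h := haxes j (X y)
      rw [hXj, hj] at h
      refine le_trans (le_of_eq ?_) h
      have := (hb j).ne'
      simp only [hr]
      field_simp
    have h2 : ∑ j, q j * y j ^ 2 ≤ m / 2 := by
      calc ∑ j, q j * y j ^ 2 ≤ ∑ _j : J, m / (2 * J.card) := by
            refine Finset.sum_le_sum fun j _ => ?_
            rw [← hqr j]
            exact mul_le_mul_of_nonneg_left (sq_le_sq' (abs_le.1 (hyr j)).1 (abs_le.1 (hyr j)).2)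
              (hq0 j)
        _ = m / 2 := by
            rw [Finset.sum_const, Finset.card_univ, Fintype.card_coe, nsmul_eq_mul]
            field_simp
    have h3 : ψ y = homExt u (X y) - ∑ j, q j * y j ^ 2 := rfl
    linarith
  refine ⟨y, hyr, fun v => ?_⟩
  set V : E n := ∑ j : J, v j • e j with hV
  have hXline : ∀ t : ℝ, X (y + t • v) = X y + t • V := by
    intro t
    simp [hX, hV, add_smul, Finset.sum_add_distrib, Finset.smul_sum, smul_smul, add_assoc]
  have hne : ∀ t : ℝ, X y + t • V ≠ 0 := fun t => hXline t ▸ hX0 _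
  have hquad : ∀ t, HasDerivAt (fun t : ℝ => ∑ j, q j * (y j + t * v j) ^ 2)
      (∑ j, 2 * q j * (y j + t * v j) * v j) t := by
    intro t
    refine HasDerivAt.fun_sum fun j _ => ?_
    have h1 : HasDerivAt (fun t : ℝ => y j + t * v j) (v j) t := by
      simpa using ((hasDerivAt_id t).mul_const (v j)).const_add (y j)
    exact ((h1.fun_pow 2).const_mul (q j)).congr_deriv (by push_cast; ring)
  have hlin : HasDerivAt (fun t : ℝ => ∑ j, 2 * q j * (y j + t * v j) * v j)
      (∑ j, 2 * q j * v j ^ 2) 0 := by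
    refine HasDerivAt.fun_sum fun j _ => ?_
    have h1 : HasDerivAt (fun t : ℝ => y j + t * v j) (v j) 0 := by
      simpa using ((hasDerivAt_id (0 : ℝ)).mul_const (v j)).const_add (y j)
    exact ((h1.const_mul (2 * q j)).mul_const (v j)).congr_deriv (by ring)
  have h2 := deriv2_nonneg_of_isLocalMin
    (fun t => (hasDerivAt_comp_line (hasFDerivAt_homExt hu (hne t))).sub (hquad t))
    ((hasDerivAt_comp_line_apply (hasFDerivAt_fderiv_homExt hu (hne 0)) V).sub hlin) (by
      have hnear : ∀ᶠ t : ℝ in nhds 0, y + t • v ∈ Set.Icc (-r) r := by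
        have hc : ∀ j, ContinuousAt (fun t : ℝ => |y j + t * v j|) 0 := fun j => by fun_prop
        have : ∀ᶠ t : ℝ in nhds 0, ∀ j, |y j + t * v j| < r j :=
          Filter.eventually_all.2 fun j => (hc j).eventually_lt_const (by simpa using hint j)
        filter_upwards [this] with t ht
        exact ⟨fun j => (abs_lt.1 (ht j)).1.le, fun j => (abs_lt.1 (ht j)).2.le⟩
      filter_upwards [hnear] with t ht
      have h := hymin ht
      have e1 : ∀ s : ℝ, ψ (y + s • v) =
          homExt u (X y + s • V) - ∑ j, q j * (y j + s * v j) ^ 2 := by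
        intro s
        simp [hψ, hXline]
      have e2 := e1 0
      rw [zero_smul, add_zero] at e2
      have h' : ψ y ≤ ψ (y + t • v) := h
      rw [e2, e1] at h'
      exact h')
  rw [zero_smul, add_zero, sub_nonneg] at h2
  refine le_trans (le_of_eq (Finset.sum_congr rfl fun j _ => ?_)) h2
  simp only [hq]
  field_simp
  ring

end

/-! ### The two estimates and their combination -/

section

variable {n : ℕ} {u : Sph n → ℝ}

/-- At the point with small second derivatives the equation bounds the longest axis by the product
of the `k` longest ones. -/
theorem rpow_axis_le {k : ℕ} (hkn : k ≤ n) {p₀ a : ℝ} (hp₀ : 0 < p₀) (ha : 0 < a)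
    {f : Sph n → ℝ} (hfa : ∀ x, a ≤ f x) (hsol : IsSolution k p₀ f u) (hpos : ∀ x, 0 < u x)
    (heven : ∀ x, u (-x) = u x) (hconv : SphericallyConvex u)
    (e : OrthonormalBasis (Fin (n + 1)) ℝ (E n)) {κ : ℝ} (hκ : 0 < κ)
    (haxes : ∀ i x, κ * homExt u (e i) * |⟪e i, x⟫| ≤ homExt u x) {P : ℝ}
    (hP : ∀ s : Finset (Fin (n + 1)), s.card = k → ∏ i ∈ s, homExt u (e i) ≤ P)
    (i : Fin (n + 1)) :
    homExt u (e i) ^ p₀ ≤ (2 * (n + 1)) ^ k * ((n + 1).choose k *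
      (k.factorial * (2 * (n + 1)) ^ k)) / (a * (κ / (2 * (n + 1))) ^ p₀) * P := by
  obtain ⟨hu, heq⟩ := hsol
  have hb : ∀ i, 0 < homExt u (e i) := fun i => homExt_pos hpos (e.orthonormal.ne_zero i)
  obtain ⟨y, hy, hdiag⟩ := exists_homHess_diag_le hu hpos heven hconv e
  set X := ∑ i, y i • e i with hX
  have hXi : ∀ i, ⟪e i, X⟫ = y i := fun i => e.orthonormal.inner_right_fintype y i
  have hX0 : X ≠ 0 := by
    intro h
    have h1 := hXi 0
    rw [h, inner_zero_right] at h1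
    linarith [(hy 0).1]
  have hXn : ‖X‖ ≤ 2 * (n + 1) := by
    calc ‖X‖ ≤ ∑ i, ‖y i • e i‖ := norm_sum_le _ _
      _ ≤ ∑ _i : Fin (n + 1), (2 : ℝ) := by
          refine Finset.sum_le_sum fun i _ => ?_
          rw [norm_smul, e.norm_eq_one, mul_one, Real.norm_of_nonneg (by linarith [(hy i).1])]
          exact (hy i).2
      _ = 2 * (n + 1) := by simp; ring
  have hXpos : 0 < ‖X‖ := norm_pos_iff.2 hX0
  have hn : (0 : ℝ) < 2 * (n + 1) := by positivity
  have hlow : κ / (2 * (n + 1)) * homExt u (e i) ≤ u (unitVec X hX0) := by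
    have h1 : κ * homExt u (e i) ≤ ‖X‖ * u (unitVec X hX0) := by
      rw [← homExt_eq hX0]
      refine le_trans ?_ (haxes i X)
      rw [hXi]
      exact le_mul_of_one_le_right (mul_pos hκ (hb i)).le ((hy i).1.trans (le_abs_self _))
    have h2 := h1.trans (mul_le_mul_of_nonneg_right hXn (hpos _).le)
    rw [div_mul_eq_mul_div, div_le_iff₀ hn, mul_comm (u _)]
    exact h2
  have hPpos : 0 ≤ (n + 1).choose k * (k.factorial * (2 * (n + 1) : ℝ) ^ k * P) := by
    obtain ⟨s, -, hs⟩ := Finset.exists_subset_card_eq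
      (show k ≤ (Finset.univ : Finset (Fin (n + 1))).card by simp; omega)
    have : 0 ≤ P := (Finset.prod_nonneg fun i _ => (hb i).le).trans (hP s hs)
    positivity
  have hsig := sigma_le_of_diag_le (k := k) (homHessMat_posSemidef hu hconv hX0 e)
    (b := fun i => homExt u (e i)) (fun i => (hb i).le) hn.le hdiag hP
  rw [Fintype.card_fin] at hsig
  have hmain : a * (κ / (2 * (n + 1)) * homExt u (e i)) ^ p₀ ≤
      (2 * (n + 1)) ^ k * ((n + 1).choose k * (k.factorial * (2 * (n + 1)) ^ k * P)) := by
    calc a * (κ / (2 * (n + 1)) * homExt u (e i)) ^ p₀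
        ≤ f (unitVec X hX0) * u (unitVec X hX0) ^ p₀ := by
          refine mul_le_mul (hfa _) (Real.rpow_le_rpow ?_ hlow hp₀.le) ?_ (ha.le.trans (hfa _))
          · exact mul_nonneg (div_pos hκ hn).le (hb i).le
          · exact Real.rpow_nonneg (mul_nonneg (div_pos hκ hn).le (hb i).le) _
      _ = ‖X‖ ^ k * sigma k (homHessMat u X e) := by
          rw [← sigmaW_unitVec hu hkn hX0 e, heq, mul_comm]
      _ ≤ ‖X‖ ^ k * ((n + 1).choose k * (k.factorial * (2 * (n + 1)) ^ k * P)) :=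
          mul_le_mul_of_nonneg_left hsig (by positivity)
      _ ≤ _ := mul_le_mul_of_nonneg_right (pow_le_pow_left₀ hXpos.le hXn k) hPpos
  rw [Real.mul_rpow (div_pos hκ hn).le (hb i).le, ← mul_assoc] at hmain
  have hc : 0 < a * (κ / (2 * (n + 1))) ^ p₀ := mul_pos ha (Real.rpow_pos_of_pos (div_pos hκ hn) _)
  rw [div_mul_eq_mul_div, le_div_iff₀ hc, mul_comm]
  exact hmain.trans (le_of_eq (by ring))

/-- At the point with large second derivatives the equation bounds the product of any `k` axes by
a power of any remaining one. -/
theorem sq_prod_axes_le {k : ℕ} (hk : 1 ≤ k) (hkn : k ≤ n) {p₀ L : ℝ} (hp₀ : 0 < p₀)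
    {f : Sph n → ℝ} (hfL : ∀ x, |f x| ≤ L) (hsol : IsSolution k p₀ f u) (hpos : ∀ x, 0 < u x)
    (heven : ∀ x, u (-x) = u x) (hconv : SphericallyConvex u)
    (e : OrthonormalBasis (Fin (n + 1)) ℝ (E n)) {κ : ℝ} (hκ : 0 < κ)
    (haxes : ∀ i x, κ * homExt u (e i) * |⟪e i, x⟫| ≤ homExt u x)
    {J : Finset (Fin (n + 1))} (hJ : J.card = k) {i₀ : Fin (n + 1)} (hi₀ : i₀ ∉ J) :
    (∏ j ∈ J, homExt u (e j)) ^ 2 ≤ (4 * k / κ ^ 2) ^ k * (1 + 2 * k / κ) ^ p₀ * L *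
      (homExt u (e i₀) ^ p₀ * homExt u (e i₀) ^ k) := by
  obtain ⟨hu, heq⟩ := hsol
  have hb : ∀ i, 0 < homExt u (e i) := fun i => homExt_pos hpos (e.orthonormal.ne_zero i)
  have hkr : (0 : ℝ) < k := by exact_mod_cast hk
  obtain ⟨y, hy, hH⟩ := exists_homHess_ge hu hpos e hκ haxes (Finset.card_pos.1 (by omega)) hi₀
  set m := homExt u (e i₀) with hm
  have hm0 : 0 < m := hb i₀
  set X := e i₀ + ∑ j : J, y j • e j with hX
  have hXi : ⟪e i₀, X⟫ = 1 := by
    rw [hX, inner_add_right, inner_sum, Finset.sum_eq_zero, add_zero]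
    · simp
    · intro j _
      rw [real_inner_smul_right, e.inner_eq_zero fun h => hi₀ (by rw [h]; exact j.2), mul_zero]
  have hX1 : 1 ≤ ‖X‖ := by
    have h := real_inner_le_norm (e i₀) X
    rwa [hXi, e.norm_eq_one, one_mul] at h
  have hX0 : X ≠ 0 := norm_pos_iff.1 (zero_lt_one.trans_le hX1)
  have hup : u (unitVec X hX0) ≤ (1 + 2 * k / κ) * m := by
    set N := homSeminorm hu hpos heven hconv
    have h1 : homExt u X ≤ (1 + 2 * k / κ) * m := by
      calc homExt u X ≤ homExt u (e i₀) + homExt u (∑ j : J, y j • e j) :=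
            homExt_add_le hu hpos heven hconv _ _
        _ ≤ m + ∑ j : J, homExt u (y j • e j) :=
            add_le_add le_rfl
              (Finset.le_sum_of_subadditive N (map_zero N).le (map_add_le_add N) Finset.univ
                fun j : J => y j • e j)
        _ ≤ m + ∑ _j : J, 2 * m / κ := by
            refine add_le_add le_rfl (Finset.sum_le_sum fun j _ => ?_)
            rw [homExt_smul heven]
            refine (mul_le_mul_of_nonneg_right (hy j) (hb j).le).trans (le_of_eq ?_)
            have := (hb j).ne'
            field_simp
        _ = (1 + 2 * k / κ) * m := by
            rw [Finset.sum_const, Finset.card_univ, Fintype.card_coe, hJ, nsmul_eq_mul]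
            ring
    rw [homExt_eq hX0] at h1
    exact (le_mul_of_one_le_left (hpos _).le hX1).trans h1
  have hpsd := homHessMat_posSemidef hu hconv hX0 e
  have hL0 : 0 ≤ L := (abs_nonneg _).trans (hfL (unitVec X hX0))
  have hc0 : 0 ≤ 1 + 2 * k / κ := by positivity
  have hdet : ∏ j : J, κ ^ 2 * homExt u (e j) ^ 2 / (4 * k * m) ≤ sigma k (homHessMat u X e) := by
    refine le_trans ?_ (det_submatrix_le_sigma hpsd hJ)
    refine prod_le_det (hpsd.submatrix _).1 (fun j => ?_) fun v => ?_
    · have := hb j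
      positivity
    · have h1 := hH v
      rw [hJ] at h1
      refine h1.trans (le_of_eq ?_)
      simp only [homHessMat, dotProduct, Matrix.mulVec, Matrix.submatrix_apply, Matrix.of_apply,
        map_sum, map_smul, sum_apply, smul_apply, smul_eq_mul, Finset.mul_sum]
      exact Finset.sum_comm.trans
        (Finset.sum_congr rfl fun i _ => Finset.sum_congr rfl fun j _ => by ring)
  have hsig : sigma k (homHessMat u X e) ≤ L * ((1 + 2 * k / κ) ^ p₀ * m ^ p₀) := by
    have h0 : 0 ≤ sigma k (homHessMat u X e) :=
      (Finset.prod_nonneg fun j _ => by have := hb j; positivity).trans hdet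
    calc sigma k (homHessMat u X e) ≤ ‖X‖ ^ k * sigma k (homHessMat u X e) :=
          le_mul_of_one_le_left h0 (one_le_pow₀ hX1)
      _ = f (unitVec X hX0) * u (unitVec X hX0) ^ p₀ := by
          rw [← sigmaW_unitVec hu hkn hX0 e, heq, mul_comm]
      _ ≤ L * ((1 + 2 * k / κ) * m) ^ p₀ :=
          mul_le_mul ((le_abs_self _).trans (hfL _)) (Real.rpow_le_rpow (hpos _).le hup hp₀.le)
            (Real.rpow_nonneg (hpos _).le _) hL0
      _ = _ := by rw [Real.mul_rpow hc0 hm0.le]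
  have hprod : ∏ j : J, κ ^ 2 * homExt u (e j) ^ 2 / (4 * k * m) =
      (κ ^ 2 / (4 * k * m)) ^ k * (∏ j ∈ J, homExt u (e j)) ^ 2 := by
    rw [← Finset.prod_coe_sort J, ← Finset.prod_pow, ← hJ, ← Fintype.card_coe J,
      ← Finset.card_univ, ← Finset.prod_const, ← Finset.prod_mul_distrib]
    exact Finset.prod_congr rfl fun j _ => by ring
  have h1 := hdet.trans hsig
  rw [hprod] at h1
  have h2 : (4 * k / κ ^ 2) ^ k * m ^ k * (κ ^ 2 / (4 * k * m)) ^ k = 1 := by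
    rw [← mul_pow, ← mul_pow]
    have : 4 * k / κ ^ 2 * m * (κ ^ 2 / (4 * k * m)) = 1 := by field_simp
    rw [this, one_pow]
  have h3 := mul_le_mul_of_nonneg_left h1
    (show 0 ≤ (4 * k / κ ^ 2) ^ k * m ^ k by positivity)
  rw [← mul_assoc, h2, one_mul] at h3
  exact h3.trans (le_of_eq (by ring))

end

/-- The numerical combination: the first two inequalities bound `b`, hence `P`, from below, and the
third transfers the bound to `m`. -/
theorem exists_lower_bound {k : ℕ} {p₀ : ℝ} (hp₀ : 0 < p₀) (hp₀k : p₀ < k) {C₁ C₂ : ℝ}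
    (hC₁ : 0 < C₁) (hC₂ : 0 < C₂) :
    ∃ c : ℝ, 0 < c ∧ ∀ b P m : ℝ, 0 < b → 0 < m → b ^ p₀ ≤ C₁ * P → P ≤ b ^ k →
      P ^ 2 ≤ C₂ * (m ^ p₀ * m ^ k) → c ≤ m := by
  set c₁ : ℝ := C₁⁻¹ ^ (k - p₀)⁻¹ with hc₁
  have hc₁0 : 0 < c₁ := Real.rpow_pos_of_pos (inv_pos.2 hC₁) _
  set c₂ : ℝ := c₁ ^ p₀ / C₁ with hc₂
  have hc₂0 : 0 < c₂ := div_pos (Real.rpow_pos_of_pos hc₁0 _) hC₁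
  have hkp : 0 < k - p₀ := sub_pos.2 hp₀k
  have hpk : 0 < p₀ + k := by linarith
  refine ⟨(c₂ ^ 2 / C₂) ^ (p₀ + k)⁻¹, by positivity, fun b P m hb hm h1 h2 h3 => ?_⟩
  have hbc : c₁ ≤ b := by
    have h4 : b ^ p₀ ≤ C₁ * b ^ (k : ℝ) := by
      rw [Real.rpow_natCast]
      exact h1.trans (mul_le_mul_of_nonneg_left h2 hC₁.le)
    have h5 : C₁⁻¹ ≤ b ^ (k - p₀) := by
      rw [Real.rpow_sub hb, inv_eq_one_div, div_le_div_iff₀ hC₁ (Real.rpow_pos_of_pos hb _)]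
      linarith
    calc c₁ ≤ (b ^ (k - p₀)) ^ (k - p₀)⁻¹ :=
          Real.rpow_le_rpow (inv_pos.2 hC₁).le h5 (inv_pos.2 hkp).le
      _ = b := Real.rpow_rpow_inv hb.le hkp.ne'
  have hPc : c₂ ≤ P := by
    rw [hc₂, div_le_iff₀ hC₁, mul_comm]
    exact (Real.rpow_le_rpow hc₁0.le hbc hp₀.le).trans h1
  have h6 : c₂ ^ 2 / C₂ ≤ m ^ (p₀ + k) := by
    rw [Real.rpow_add hm, Real.rpow_natCast, div_le_iff₀ hC₂, mul_comm]
    exact (pow_le_pow_left₀ hc₂0.le hPc 2).trans h3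
  calc (c₂ ^ 2 / C₂) ^ (p₀ + k)⁻¹ ≤ (m ^ (p₀ + k)) ^ (p₀ + k)⁻¹ :=
        Real.rpow_le_rpow (by positivity) h6 (inv_pos.2 hpk).le
    _ = m := Real.rpow_rpow_inv hm.le hpk.ne'

end LpCM

end

theorem proposition4p1 (n k : ℕ) (hk : 1 ≤ k) (hkn : k < n) (p₀ : ℝ) (hp₀ : 0 < p₀)
    (hp₀k : p₀ < k) (a L : ℝ) (ha : 0 < a) :
    ∃ C : ℝ, 0 < C ∧ ∀ f u : LpCM.Sph n → ℝ,
      ContMDiff (𝓡 n) 𝓘(ℝ, ℝ) 1 f →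
      (∀ x, a ≤ f x) →
      (∀ x, |f x| ≤ L) →
      (∀ x, ‖LpCM.sphGrad f x‖ ≤ L) →
      LpCM.IsSolution k p₀ f u →
      (∀ x, 0 < u x) →
      (∀ x, u (-x) = u x) →
      LpCM.SphericallyConvex u →
      ∀ x, C ≤ u x := by
  set κ : ℝ := (2 ^ (n + 1))⁻¹ with hκdef
  have hκ : 0 < κ := by positivity
  have hch : 0 < (n + 1).choose k := Nat.choose_pos (by omega)
  have hkr : (0 : ℝ) < k := by exact_mod_cast hk
  obtain ⟨c, hc, hlow⟩ := LpCM.exists_lower_bound hp₀ hp₀k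
    (C₁ := (2 * (n + 1)) ^ k * ((n + 1).choose k * (k.factorial * (2 * (n + 1)) ^ k)) /
      (a * (κ / (2 * (n + 1))) ^ p₀))
    (C₂ := (4 * k / κ ^ 2) ^ k * (1 + 2 * k / κ) ^ p₀ * max L 1) (by positivity) (by positivity)
  refine ⟨κ / (n + 1) * c, by positivity, fun f u _ hfa hfL _ hsol hpos heven hconv x => ?_⟩
  have hu := hsol.1
  obtain ⟨e, he⟩ := LpCM.exists_orthonormal_axes (LpCM.homSeminorm hu hpos heven hconv)
    (LpCM.continuous_homExt hu)
  have hb : ∀ i, 0 < LpCM.homExt u (e i) := fun i =>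
    LpCM.homExt_pos hpos (e.orthonormal.ne_zero i)
  have haxes : ∀ i x, κ * LpCM.homExt u (e i) * |inner ℝ (e i) x| ≤ LpCM.homExt u x := by
    intro i x
    have h : LpCM.homExt u (e i) * |inner ℝ (e i) x| ≤ 2 ^ (n + 1) * LpCM.homExt u x := he i x
    rw [mul_assoc, hκdef, inv_mul_le_iff₀ (by positivity)]
    exact h
  obtain ⟨i₀, hi₀⟩ := Finite.exists_min fun i => LpCM.homExt u (e i)
  obtain ⟨i₁, hi₁⟩ := Finite.exists_max fun i => LpCM.homExt u (e i)
  obtain ⟨J, hJ, hi₀J, hJmax⟩ := LpCM.exists_max_prod (k := k) (by simp; omega) hb hi₀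
  have hm : c ≤ LpCM.homExt u (e i₀) := by
    refine hlow (LpCM.homExt u (e i₁)) (∏ j ∈ J, LpCM.homExt u (e j)) _ (hb i₁) (hb i₀)
      (LpCM.rpow_axis_le hkn.le hp₀ ha hfa hsol hpos heven hconv e hκ haxes hJmax i₁) ?_
      (LpCM.sq_prod_axes_le hk hkn.le hp₀ (fun x => (hfL x).trans (le_max_left L 1)) hsol hpos
        heven hconv e hκ haxes hJ hi₀J)
    rw [← hJ, ← Finset.prod_const]
    exact Finset.prod_le_prod (fun j _ => (hb j).le) fun j _ => hi₁ j
  -- Some coordinate of `x` has size at least `1 / (n + 1)`.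
  have hsum : 1 ≤ ∑ i, |inner ℝ (e i) (x : LpCM.E n)| := by
    calc (1 : ℝ) = ‖(x : LpCM.E n)‖ := (norm_eq_of_mem_sphere x).symm
      _ = ‖∑ i, inner ℝ (e i) (x : LpCM.E n) • e i‖ := by rw [e.sum_repr']
      _ ≤ ∑ i, ‖inner ℝ (e i) (x : LpCM.E n) • e i‖ := norm_sum_le _ _
      _ = _ := by simp [norm_smul]
  have hall : ∑ i, κ * c * |inner ℝ (e i) (x : LpCM.E n)| ≤ (n + 1) * u x := by
    calc ∑ i, κ * c * |inner ℝ (e i) (x : LpCM.E n)| ≤ ∑ _i : Fin (n + 1), u x := by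
          refine Finset.sum_le_sum fun i _ => ?_
          rw [← LpCM.homExt_coe (u := u) x]
          refine le_trans ?_ (haxes i x)
          exact mul_le_mul_of_nonneg_right
            (mul_le_mul_of_nonneg_left (hm.trans (hi₀ i)) hκ.le) (abs_nonneg _)
      _ = (n + 1) * u x := by simp
  rw [← Finset.mul_sum] at hall
  have hκc : 0 < κ * c := mul_pos hκ hc
  have h1 := (le_mul_of_one_le_right hκc.le hsum).trans hall
  rw [div_mul_eq_mul_div, div_le_iff₀ (by positivity), mul_comm (u x)]
  exact h1
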